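/- Let $p$ be a prime, $m\ge 1$ an integer, $v$ the $p$-adic valuation and $|\cdot|$ the $p$-adic norm on $\mathbb{Q}_p$, $|x|=p^{-v(x)}$. Let $dx$ be the Haar measure on $\mathbb{Q}_p$ with $\mathbb{Z}_p$ of measure $1$, let $d\mu^\times=dx/|x|$, let $E=\bigcup_{s=0}^{m-1}p^s\mathbb{Z}_p^\times$ (a fundamental domain of $\mathbb{Q}_p^\times/p^{m\mathbb{Z}}$), and put $V=\mu^\times(E)=m(1-p^{-1})$. Define $$D\phi(x)=\int_E\frac{\phi(z)-\phi(x)}{|z-x|^2}\,|x|\,dz ,$$ where $D$ acts on the first variable of a function of two variables. A symmetric Green's function for $D$ is a symmetric real function $G(x,y)$ on $E\times E$ that is continuous off the diagonal (the values on the diagonal are irrelevant), $\mu^\times$-integrable in $x$ for each $y$, and satisfies $DG(\cdot,y)=\delta_y-\frac1V$ as distributions on $E$, i.e. for every $y\in E$ and every locally constant $\phi:E\to\mathbb{R}$ $$\int_E G(x,y)\,D\phi(x)\,d\mu^\times(x)=\phi(y)-\frac1V\int_E\phi\,d\mu^\times .$$ For $x,y\in E$ and $n\geq 1$ put $d(x,y)=\dfrac{|x-y|}{\max(|x|,|y|)}$,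 $U(y)=|y|+p^{1-m}|y|^{-1}$, $$\lambda_0=\frac{p(p-1)}{p+1},\qquad \lambda_n(y)=U(y)^n\,\frac{p^{n+1}-1}{(p-1)(p+1)^n(p^n-1)}\,\lambda_0,\qquad A(y)=-\sum_{n\ge1}\lambda_n(y),$$ $$B(x,y)=A(y)+\lambda_0\log_p d(x,y)+\sum_{n\ge1}\lambda_n(y)\,d(x,y)^n\qquad(x\ne y).$$ Then: 1. There is a function $C(x,y)$ depending only on $|x|$ and $|y|$ such that $B+C$ is a symmetric Green's function for $D$; and for every symmetric Green's function $G$ for $D$ there is a function $C(x,y)$ depending only on $|x|$ and $|y|$ with $G(x,y)=B(x,y)+C(x,y)$ for all $x\neq y$ in $E$. 2. The series $\sum_{n\ge1}\lambda_n(y)$ and $\sum_{n\ge1}\lambda_n(y)d(x,y)^n$ converge absolutely for all $x,y\in E$. 3. For all $x\ne y$ in $E$ the integrals defining $DB(x,y)$, $D\log_p d(x,y)$ and $D\,d(x,y)^n$ ($n\ge1$) converge absolutely, the series $\sum_{n\ge1}\lambda_n(y)\,D\,d(x,y)^n$ converges absolutely, and $$DB(x,y)=\lambda_0\,D\log_p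 d(x,y)+\sum_{n\ge1}\lambda_n(y)\,D\,d(x,y)^n=-\lambda_0\,p^{-|v(x)-v(y)|}\,\frac{p+1}{(p-1)(p+1-U(y))} .$$ In particular, for $x\ne y$, $DB(x,y)$ depends only on $|x|$ and $|y|$. -/

import Mathlib

namespace TateCurve

/-- `ℚ_p` with its Borel σ-algebra. -/
noncomputable instance instMeasurableSpacePadic (p : ℕ) [Fact p.Prime] : MeasurableSpace ℚ_[p] :=
  borel ℚ_[p]

instance instBorelSpacePadic (p : ℕ) [Fact p.Prime] : BorelSpace ℚ_[p] := ⟨rfl⟩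

/-- `ℤ_p`, the closed unit ball of `ℚ_p`, as a compact set with non-empty interior. -/
def unitBall (p : ℕ) [Fact p.Prime] : TopologicalSpace.PositiveCompacts ℚ_[p] where
  carrier := Metric.closedBall 0 1
  isCompact' := isCompact_closedBall 0 1
  interior_nonempty' :=
    ⟨0, Metric.ball_subset_interior_closedBall (Metric.mem_ball_self one_pos)⟩

/-- The additive Haar measure `μ⁺ = dx` on `ℚ_p` with `μ⁺(ℤ_p) = 1`. -/
noncomputable def addHaar (p : ℕ) [Fact p.Prime] : MeasureTheory.Measure ℚ_[p] :=
  MeasureTheory.Measure.addHaarMeasure (unitBall p)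

/-- The multiplicative Haar measure `μ^× = dx / |x|`. -/
noncomputable def mulHaar (p : ℕ) [Fact p.Prime] : MeasureTheory.Measure ℚ_[p] :=
  (addHaar p).withDensity fun x => ENNReal.ofReal ‖x‖⁻¹

/-- The fundamental domain `E = ⋃_{s=0}^{m-1} p^s ℤ_p^×` of `ℚ_p^× / p^{mℤ}`. -/
def E (p : ℕ) [Fact p.Prime] (m : ℕ) : Set ℚ_[p] :=
  {x | ∃ s : ℕ, s < m ∧ ∃ u : ℤ_[p]ˣ, x = (p : ℚ_[p]) ^ s * ((u : ℤ_[p]) : ℚ_[p])}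

/-- The integrand `(φ(z) - φ(x)) |x| / |z - x|²` of `Dφ(x)`. -/
noncomputable def kernelD (p : ℕ) [Fact p.Prime] (φ : ℚ_[p] → ℝ) (x z : ℚ_[p]) : ℝ :=
  (φ z - φ x) / ‖z - x‖ ^ 2 * ‖x‖

/-- The flat Laplacian `Dφ(x) = ∫_E (φ(z) - φ(x)) / |z - x|² |x| dz`. -/
noncomputable def D (p : ℕ) [Fact p.Prime] (m : ℕ) (φ : ℚ_[p] → ℝ) (x : ℚ_[p]) : ℝ :=
  ∫ z in E p m, kernelD p φ x z ∂(addHaar p)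

/-- The integral that defines `Dφ(x)` converges absolutely. -/
def DConverges (p : ℕ) [Fact p.Prime] (m : ℕ) (φ : ℚ_[p] → ℝ) (x : ℚ_[p]) : Prop :=
  MeasureTheory.IntegrableOn (kernelD p φ x) (E p m) (addHaar p)

/-- A symmetric Green's function for `D`, as a function on `E × E` minus the diagonal (the values
on the diagonal, a null set in each variable, play no role): symmetric, continuous off the
diagonal, integrable in the first variable, and satisfying `D G(·, y) = δ_y - 1 / V`, `V = μ^×(E)`,
in the sense of distributions on `E` with respect to the pairing `⟨f, g⟩ = ∫_E f g dμ^×`, for which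
`D` is formally self-adjoint. Since `E` is open and closed, the locally constant functions on `E`
are the restrictions of those on `ℚ_p`. -/
structure IsGreen (p : ℕ) [Fact p.Prime] (m : ℕ) (G : ℚ_[p] → ℚ_[p] → ℝ) : Prop where
  symm : ∀ x ∈ E p m, ∀ y ∈ E p m, G x y = G y x
  continuousOn : ContinuousOn (fun w : ℚ_[p] × ℚ_[p] => G w.1 w.2)
    {w | w.1 ∈ E p m ∧ w.2 ∈ E p m ∧ w.1 ≠ w.2}
  integrableOn : ∀ y ∈ E p m,
    MeasureTheory.IntegrableOn (fun x => G x y) (E p m) (mulHaar p)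
  green : ∀ y ∈ E p m, ∀ φ : ℚ_[p] → ℝ, IsLocallyConstant φ →
    ∫ x in E p m, G x y * D p m φ x ∂(mulHaar p) =
      φ y - 1 / (mulHaar p).real (E p m) * ∫ x in E p m, φ x ∂(mulHaar p)

/-- `d(x, y) = |x - y| / max(|x|, |y|)`. -/
noncomputable def d (p : ℕ) [Fact p.Prime] (x y : ℚ_[p]) : ℝ := ‖x - y‖ / max ‖x‖ ‖y‖

/-- `U(y) = |y| + p^{1-m} |y|⁻¹`. -/
noncomputable def U (p : ℕ) [Fact p.Prime] (m : ℕ) (y : ℚ_[p]) : ℝ :=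
  ‖y‖ + (p : ℝ) ^ (1 - (m : ℤ)) * ‖y‖⁻¹

/-- `λ₀ = p (p - 1) / (p + 1)`. -/
noncomputable def lambda0 (p : ℕ) : ℝ := (p : ℝ) * ((p : ℝ) - 1) / ((p : ℝ) + 1)

/-- `λ_n(y)`; only used for `n ≥ 1`. -/
noncomputable def lambda (p : ℕ) [Fact p.Prime] (m n : ℕ) (y : ℚ_[p]) : ℝ :=
  U p m y ^ n * (((p : ℝ) ^ (n + 1) - 1) /
    (((p : ℝ) - 1) * ((p : ℝ) + 1) ^ n * ((p : ℝ) ^ n - 1))) * lambda0 p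

/-- `A(y) = -∑_{n ≥ 1} λ_n(y)`. -/
noncomputable def A (p : ℕ) [Fact p.Prime] (m : ℕ) (y : ℚ_[p]) : ℝ :=
  -∑' n : ℕ, lambda p m (n + 1) y

/-- `B(x, y) = A(y) + λ₀ log_p d(x, y) + ∑_{n ≥ 1} λ_n(y) d(x, y)^n`. -/
noncomputable def B (p : ℕ) [Fact p.Prime] (m : ℕ) (x y : ℚ_[p]) : ℝ :=
  A p m y + lambda0 p * Real.logb p (d p x y) +
    ∑' n : ℕ, lambda p m (n + 1) y * d p x y ^ (n + 1)

end TateCurve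

/-!
For fixed `y`, `B(·, y)` is a function of `d(·, y)` alone, hence a combination of indicators of the
balls `{z | d(z, y) ≤ p^(-k-1)}`, `k ≥ 0`. Write `r = U(y) / (p + 1)`, which lies in `[0, 1)` for
`y` in `E`. The coefficients `λ_n` are chosen so that the `k`-th ball has weight
`-λ₀ / ((1 - r p^(-k)) (1 - r p^(-k-1)))`. With these weights the values of `D` on the indicators
form a telescoping series, whose sum depends on `x` through `|x|` only.

On functions of the norm, `D` is the Laplacian of a finite complete graph with vertices the `m`
spheres that make up `E`, and `DB(x, y)` is proportional to the weight of the edge `|x|, |y|`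
divided by the degree of the vertex `|y|`. Inverting this Laplacian off the constants gives a
symmetric `C(|x|, |y|)` for which `D(B + C)` is the constant `-1 / V` off the diagonal. Because the
kernel of `D` is symmetric with respect to `μ^×`, a function that is locally constant away from `y`
and has constant `D` there satisfies Green's identity against every locally constant `φ`; the point
mass at `y` is then forced by `∫ Dφ dμ^× = 0`.

Two Green's functions differ by an `H` orthogonal to every `Dφ`. Testing against the average of `H`
over balls of a fixed radius makes the Dirichlet energy of that average vanish, so it is constant;
letting the radius tend to `0`, `H` itself is constant.
-/

namespace TateCurve

open MeasureTheory Metric Filter Topology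

variable {p : ℕ} [Fact p.Prime]

section Ultrametric

variable {S : Type*} [SeminormedAddCommGroup S] [IsUltrametricDist S]

theorem norm_sub_le_max (a b : S) : ‖a - b‖ ≤ max ‖a‖ ‖b‖ := by
  simpa only [dist_eq_norm, sub_zero, zero_sub, norm_neg] using dist_triangle_max a 0 b

theorem norm_eq_of_norm_sub_lt {a b : S} (h : ‖a - b‖ < ‖b‖) : ‖a‖ = ‖b‖ :=
  (IsUltrametricDist.norm_eq_of_add_norm_lt_max (x := a) (y := -b) <| by
    simpa [← sub_eq_add_neg] using Or.inr h).trans (norm_neg b)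

theorem norm_sub_eq_max_of_norm_ne {a b : S} (h : ‖a‖ ≠ ‖b‖) : ‖a - b‖ = max ‖a‖ ‖b‖ := by
  rw [sub_eq_add_neg, IsUltrametricDist.norm_add_eq_max_of_norm_ne_norm (by simpa using h),
    norm_neg]

theorem norm_sub_eq_of_norm_sub_lt {a b c : S} (h : ‖a - b‖ < ‖b - c‖) :
    ‖a - c‖ = ‖b - c‖ :=
  norm_eq_of_norm_sub_lt (by simpa using h)

theorem eventually_norm_eq {X : Type*} [TopologicalSpace X] {f : X → S} {a : X}
    (hf : ContinuousAt f a) (ha : ‖f a‖ ≠ 0) :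
    ∀ᶠ w in 𝓝 a, ‖f w‖ = ‖f a‖ :=
  (hf.eventually (ball_mem_nhds (f a) ((norm_nonneg _).lt_of_ne' ha))).mono fun w hw =>
    norm_eq_of_norm_sub_lt (by simpa [dist_eq_norm] using hw)

end Ultrametric

section NormValues

theorem one_lt_cast_prime : (1 : ℝ) < p := by exact_mod_cast (Fact.out : p.Prime).one_lt

theorem cast_prime_pos : (0 : ℝ) < p := zero_lt_one.trans one_lt_cast_prime

theorem inv_prime_pos : (0 : ℝ) < (p : ℝ)⁻¹ := inv_pos.2 cast_prime_pos

theorem inv_prime_lt_one : (p : ℝ)⁻¹ < 1 := inv_lt_one_of_one_lt₀ one_lt_cast_prime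

theorem inv_prime_pow_pos (k : ℕ) : (0 : ℝ) < (p : ℝ)⁻¹ ^ k := pow_pos inv_prime_pos k

theorem inv_prime_pow_le_one (k : ℕ) : (p : ℝ)⁻¹ ^ k ≤ 1 :=
  pow_le_one₀ inv_prime_pos.le inv_prime_lt_one.le

theorem inv_prime_pow_lt_iff {i j : ℕ} : (p : ℝ)⁻¹ ^ i < (p : ℝ)⁻¹ ^ j ↔ j < i :=
  pow_lt_pow_iff_right_of_lt_one₀ inv_prime_pos inv_prime_lt_one

theorem inv_prime_pow_le_iff {i j : ℕ} : (p : ℝ)⁻¹ ^ i ≤ (p : ℝ)⁻¹ ^ j ↔ j ≤ i :=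
  pow_le_pow_iff_right_of_lt_one₀ inv_prime_pos inv_prime_lt_one

theorem inv_prime_pow_injective : Function.Injective fun i : ℕ => (p : ℝ)⁻¹ ^ i :=
  pow_right_injective₀ inv_prime_pos inv_prime_lt_one.ne

theorem tendsto_inv_prime_pow : Tendsto (fun k : ℕ => (p : ℝ)⁻¹ ^ k) atTop (𝓝 0) :=
  tendsto_pow_atTop_nhds_zero_of_lt_one inv_prime_pos.le inv_prime_lt_one

theorem norm_prime_pow (k : ℕ) : ‖(p : ℚ_[p]) ^ k‖ = (p : ℝ)⁻¹ ^ k := by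
  rw [norm_pow, Padic.norm_p]

theorem exists_norm_eq_inv_prime_pow {z : ℚ_[p]} (hz : z ≠ 0) (h : ‖z‖ ≤ 1) :
    ∃ i : ℕ, ‖z‖ = (p : ℝ)⁻¹ ^ i := by
  obtain ⟨n, hn⟩ := Int.eq_ofNat_of_zero_le ((Padic.norm_le_one_iff_val_nonneg z).1 h)
  exact ⟨n, by rw [Padic.norm_eq_zpow_neg_valuation hz, hn, zpow_neg, inv_pow, zpow_natCast]⟩

theorem norm_le_inv_prime_pow_succ {z : ℚ_[p]} {k : ℕ} (h : ‖z‖ < (p : ℝ)⁻¹ ^ k) :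
    ‖z‖ ≤ (p : ℝ)⁻¹ ^ (k + 1) := by
  rcases eq_or_ne z 0 with rfl | hz
  · simp
  · obtain ⟨i, hi⟩ := exists_norm_eq_inv_prime_pow hz (h.le.trans (inv_prime_pow_le_one k))
    rw [hi] at h ⊢
    exact inv_prime_pow_le_iff.2 (inv_prime_pow_lt_iff.1 h)

end NormValues

section Haar

instance : (addHaar p).IsAddHaarMeasure := by unfold addHaar; infer_instance

theorem closedBall_eq_biUnion (k : ℕ) :
    closedBall (0 : ℚ_[p]) ((p : ℝ)⁻¹ ^ k) =
      ⋃ a ∈ Finset.range p, closedBall ((a : ℚ_[p]) * (p : ℚ_[p]) ^ k) ((p : ℝ)⁻¹ ^ (k + 1)) := by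
  ext z
  simp only [Set.mem_iUnion, mem_closedBall, dist_eq_norm, sub_zero, Finset.mem_range, exists_prop]
  have hp0 : (p : ℚ_[p]) ^ k ≠ 0 := pow_ne_zero _ (NeZero.ne _)
  constructor
  · intro hz
    have hw : ‖z / (p : ℚ_[p]) ^ k‖ ≤ 1 := by
      rw [norm_div, norm_prime_pow]
      exact div_le_one_of_le₀ hz (inv_prime_pow_pos k).le
    obtain ⟨a, ha, haw⟩ := PadicInt.exists_mem_range (⟨z / (p : ℚ_[p]) ^ k, hw⟩ : ℤ_[p])
    have hlt : ‖z / (p : ℚ_[p]) ^ k - a‖ < 1 :=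
      PadicInt.mem_nonunits.1 ((IsLocalRing.mem_maximalIdeal _).1 haw)
    refine ⟨a, ha, norm_le_inv_prime_pow_succ ?_⟩
    rw [← div_mul_cancel₀ z hp0, ← sub_mul, norm_mul, norm_prime_pow]
    exact mul_lt_of_lt_one_left (inv_prime_pow_pos k) hlt
  · rintro ⟨a, -, h⟩
    have hcenter : ‖(a : ℚ_[p]) * (p : ℚ_[p]) ^ k‖ ≤ (p : ℝ)⁻¹ ^ k := by
      rw [norm_mul, norm_prime_pow]
      exact mul_le_of_le_one_left (inv_prime_pow_pos k).le
        (by exact_mod_cast Padic.norm_int_le_one (a : ℤ))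
    have hsum := IsUltrametricDist.norm_add_le_max (z - a * (p : ℚ_[p]) ^ k) (a * (p : ℚ_[p]) ^ k)
    rw [sub_add_cancel] at hsum
    exact hsum.trans (max_le (h.trans (inv_prime_pow_le_iff.2 k.le_succ)) hcenter)

theorem pairwiseDisjoint_closedBall (k : ℕ) :
    (↑(Finset.range p) : Set ℕ).PairwiseDisjoint fun a =>
      closedBall ((a : ℚ_[p]) * (p : ℚ_[p]) ^ k) ((p : ℝ)⁻¹ ^ (k + 1)) := by
  intro a ha b hb hab
  simp only [Finset.coe_range, Set.mem_Iio] at ha hb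
  refine Set.disjoint_left.2 fun z hza hzb => ?_
  have hunit : ‖(((a : ℤ) - (b : ℤ) : ℤ) : ℚ_[p])‖ = 1 := by
    refine le_antisymm (Padic.norm_int_le_one _) (not_lt.1 fun hlt => ?_)
    rw [Padic.norm_intCast_lt_one_iff] at hlt
    have := Int.eq_zero_of_abs_lt_dvd hlt (by rw [abs_lt]; lia)
    lia
  have hle : dist ((a : ℚ_[p]) * (p : ℚ_[p]) ^ k) (b * (p : ℚ_[p]) ^ k) ≤ (p : ℝ)⁻¹ ^ (k + 1) :=
    (dist_triangle_max _ z _).trans (max_le (mem_closedBall'.1 hza) (mem_closedBall.1 hzb))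
  rw [dist_eq_norm, ← sub_mul, norm_mul, norm_prime_pow] at hle
  push_cast at hunit
  rw [hunit, one_mul, inv_prime_pow_le_iff] at hle
  lia

theorem addHaar_closedBall_eq_addHaar_closedBall_zero (a : ℚ_[p]) (r : ℝ) :
    addHaar p (closedBall a r) = addHaar p (closedBall 0 r) := by
  rw [← measure_preimage_add (addHaar p) (-a) (closedBall 0 r)]
  congr 1
  ext z
  simp [dist_eq_norm, sub_eq_neg_add]

theorem addHaar_closedBall (a : ℚ_[p]) (k : ℕ) :
    addHaar p (closedBall a ((p : ℝ)⁻¹ ^ k)) = ENNReal.ofReal ((p : ℝ)⁻¹ ^ k) := by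
  rw [addHaar_closedBall_eq_addHaar_closedBall_zero]
  induction k with
  | zero => simpa using! Measure.addHaarMeasure_self (K₀ := unitBall p)
  | succ k ih =>
    rw [closedBall_eq_biUnion, measure_biUnion_finset (pairwiseDisjoint_closedBall k)
      fun a _ => isClosed_closedBall.measurableSet] at ih
    simp only [addHaar_closedBall_eq_addHaar_closedBall_zero, Finset.sum_const, Finset.card_range,
      nsmul_eq_mul] at ih
    refine (ENNReal.mul_right_inj (by simpa using NeZero.ne p) (ENNReal.natCast_ne_top p)).1 ?_
    rw [ih, ← ENNReal.ofReal_natCast, ← ENNReal.ofReal_mul cast_prime_pos.le, pow_succ',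
      mul_inv_cancel_left₀ cast_prime_pos.ne']

theorem addHaar_real_closedBall (a : ℚ_[p]) (k : ℕ) :
    (addHaar p).real (closedBall a ((p : ℝ)⁻¹ ^ k)) = (p : ℝ)⁻¹ ^ k := by
  rw [measureReal_def, addHaar_closedBall, ENNReal.toReal_ofReal (inv_prime_pow_pos k).le]

theorem sphere_eq_diff (y : ℚ_[p]) (i : ℕ) :
    sphere y ((p : ℝ)⁻¹ ^ i) =
      closedBall y ((p : ℝ)⁻¹ ^ i) \ closedBall y ((p : ℝ)⁻¹ ^ (i + 1)) := by
  ext z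
  simp only [mem_sphere, Set.mem_sdiff, mem_closedBall, not_le, dist_eq_norm]
  refine ⟨fun h => ⟨h.le, (inv_prime_pow_lt_iff.2 i.lt_succ_self).trans_eq h.symm⟩,
    fun ⟨hle, hlt⟩ => ?_⟩
  exact hle.antisymm (not_lt.1 fun h => hlt.not_ge (norm_le_inv_prime_pow_succ h))

theorem addHaar_real_sphere (y : ℚ_[p]) (i : ℕ) :
    (addHaar p).real (sphere y ((p : ℝ)⁻¹ ^ i)) = (p : ℝ)⁻¹ ^ i * (1 - (p : ℝ)⁻¹) := by
  rw [sphere_eq_diff, measureReal_sdiff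
      (closedBall_subset_closedBall (inv_prime_pow_le_iff.2 (Nat.le_add_right i 1)))
      isClosed_closedBall.measurableSet (isCompact_closedBall _ _).measure_ne_top,
    addHaar_real_closedBall, addHaar_real_closedBall, pow_succ]
  ring

theorem closedBall_diff_closedBall_eq_biUnion_sphere (y : ℚ_[p]) (n : ℕ) :
    closedBall y 1 \ closedBall y ((p : ℝ)⁻¹ ^ n) =
      ⋃ i ∈ Finset.range n, sphere y ((p : ℝ)⁻¹ ^ i) := by
  ext z
  simp only [Set.mem_sdiff, mem_closedBall, not_le, Set.mem_iUnion, Finset.mem_range, mem_sphere,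
    exists_prop, dist_eq_norm]
  constructor
  · rintro ⟨hle, hlt⟩
    obtain ⟨i, hi⟩ := exists_norm_eq_inv_prime_pow
      (norm_pos_iff.1 ((inv_prime_pow_pos n).trans hlt)) hle
    exact ⟨i, inv_prime_pow_lt_iff.1 (hi ▸ hlt), hi⟩
  · rintro ⟨i, hi, hz⟩
    exact hz ▸ ⟨inv_prime_pow_le_one i, inv_prime_pow_lt_iff.2 hi⟩

theorem setIntegral_closedBall_diff_closedBall (y : ℚ_[p]) (n : ℕ) (f : ℝ → ℝ) :
    ∫ z in closedBall y 1 \ closedBall y ((p : ℝ)⁻¹ ^ n), f ‖z - y‖ ∂addHaar p =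
      (1 - (p : ℝ)⁻¹) * ∑ i ∈ Finset.range n, (p : ℝ)⁻¹ ^ i * f ((p : ℝ)⁻¹ ^ i) := by
  have hconst : ∀ i, Set.EqOn (fun z => f ‖z - y‖) (fun _ => f ((p : ℝ)⁻¹ ^ i))
      (sphere y ((p : ℝ)⁻¹ ^ i)) := fun i z hz =>
    congrArg f ((dist_eq_norm z y).symm.trans (mem_sphere.1 hz))
  have hmeas : ∀ i, MeasurableSet (sphere y ((p : ℝ)⁻¹ ^ i)) := fun i =>
    isClosed_sphere.measurableSet
  rw [closedBall_diff_closedBall_eq_biUnion_sphere, integral_biUnion_finset _ fun i _ => hmeas i,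
    Finset.mul_sum]
  · refine Finset.sum_congr rfl fun i _ => ?_
    rw [setIntegral_congr_fun (hmeas i) (hconst i), setIntegral_const, addHaar_real_sphere,
      smul_eq_mul]
    ring
  · intro i _ j _ hij
    refine Set.disjoint_left.2 fun z hi hj => hij (inv_prime_pow_injective (p := p) ?_)
    exact (mem_sphere.1 hi).symm.trans (mem_sphere.1 hj)
  · exact fun i _ => (integrableOn_const (isCompact_sphere _ _).measure_ne_top).congr_fun
      (hconst i).symm (hmeas i)

end Haar

section FundamentalDomain

variable {m : ℕ}

/-- The finite set `|E| = {1, p⁻¹, …, p^(1 - m)}` of norms of elements of `E`. -/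
noncomputable def normValues (p m : ℕ) : Finset ℝ :=
  (Finset.range m).image fun i => (p : ℝ)⁻¹ ^ i

theorem mem_E_iff {x : ℚ_[p]} : x ∈ E p m ↔ ‖x‖ ∈ normValues p m := by
  simp only [normValues, Finset.mem_image, Finset.mem_range]
  constructor
  · rintro ⟨s, hs, u, rfl⟩
    refine ⟨s, hs, ?_⟩
    rw [norm_mul, norm_prime_pow, ← PadicInt.norm_def, PadicInt.norm_units, mul_one]
  · rintro ⟨s, hs, hx⟩
    have hunit : ‖x / (p : ℚ_[p]) ^ s‖ = 1 := by
      rw [norm_div, norm_prime_pow, ← hx, div_self (inv_prime_pow_pos s).ne']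
    refine ⟨s, hs, PadicInt.mkUnits hunit, ?_⟩
    rw [PadicInt.mkUnits_eq, mul_div_cancel₀ _ (pow_ne_zero _ (NeZero.ne _))]

theorem E_eq_biUnion_sphere : E p m = ⋃ i ∈ Finset.range m, sphere 0 ((p : ℝ)⁻¹ ^ i) := by
  ext x
  simp [mem_E_iff, normValues, eq_comm]

theorem E_eq_diff : E p m = closedBall 0 1 \ closedBall 0 ((p : ℝ)⁻¹ ^ m) := by
  rw [closedBall_diff_closedBall_eq_biUnion_sphere, E_eq_biUnion_sphere]

theorem isClopen_closedBall_inv_prime_pow (y : ℚ_[p]) (k : ℕ) :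
    IsClopen (closedBall y ((p : ℝ)⁻¹ ^ k)) :=
  IsUltrametricDist.isClopen_closedBall y (inv_prime_pow_pos k).ne'

theorem isClopen_E : IsClopen (E p m) := by
  rw [E_eq_diff, ← pow_zero (p : ℝ)⁻¹]
  exact (isClopen_closedBall_inv_prime_pow 0 0).diff (isClopen_closedBall_inv_prime_pow 0 m)

theorem measurableSet_E : MeasurableSet (E p m) := isClopen_E.isClosed.measurableSet

theorem isCompact_E : IsCompact (E p m) :=
  (isCompact_closedBall 0 1).of_isClosed_subset isClopen_E.isClosed
    (E_eq_diff.trans_subset Set.sdiff_subset)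

instance : IsFiniteMeasure ((addHaar p).restrict (E p m)) :=
  isFiniteMeasure_restrict.2 isCompact_E.measure_ne_top

theorem norm_le_one_of_mem_E {x : ℚ_[p]} (hx : x ∈ E p m) : ‖x‖ ≤ 1 := by
  simpa using (E_eq_diff.subset hx).1

theorem inv_prime_pow_lt_norm_of_mem_E {x : ℚ_[p]} (hx : x ∈ E p m) : (p : ℝ)⁻¹ ^ m < ‖x‖ := by
  simpa using (E_eq_diff.subset hx).2

theorem norm_pos_of_mem_E {x : ℚ_[p]} (hx : x ∈ E p m) : 0 < ‖x‖ :=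
  (inv_prime_pow_pos m).trans (inv_prime_pow_lt_norm_of_mem_E hx)

theorem exists_norm_eq_of_mem_E {x : ℚ_[p]} (hx : x ∈ E p m) :
    ∃ s < m, ‖x‖ = (p : ℝ)⁻¹ ^ s := by
  simpa [mem_E_iff, normValues, eq_comm] using hx

theorem mem_E_of_norm_eq {x y : ℚ_[p]} (h : ‖x‖ = ‖y‖) (hy : y ∈ E p m) : x ∈ E p m := by
  rwa [mem_E_iff, h, ← mem_E_iff]

theorem setIntegral_E_norm (f : ℝ → ℝ) :
    ∫ z in E p m, f ‖z‖ ∂addHaar p = (1 - (p : ℝ)⁻¹) * ∑ a ∈ normValues p m, a * f a := by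
  rw [normValues, Finset.sum_image inv_prime_pow_injective.injOn]
  simpa [E_eq_diff] using setIntegral_closedBall_diff_closedBall (0 : ℚ_[p]) m f

theorem continuousOn_norm_inv_E : ContinuousOn (fun x : ℚ_[p] => ‖x‖⁻¹) (E p m) :=
  continuousOn_id.norm.inv₀ fun _ hx => (norm_pos_of_mem_E hx).ne'

theorem setIntegral_mulHaar (f : ℚ_[p] → ℝ) :
    ∫ x in E p m, f x ∂mulHaar p = ∫ x in E p m, ‖x‖⁻¹ * f x ∂addHaar p := by
  rw [mulHaar, setIntegral_withDensity_eq_setIntegral_toReal_smul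
    (by fun_prop) (by simp) _ measurableSet_E]
  simp

theorem integrableOn_mulHaar_iff {f : ℚ_[p] → ℝ} :
    IntegrableOn f (E p m) (mulHaar p) ↔ IntegrableOn f (E p m) (addHaar p) := by
  have hdensity : IntegrableOn f (E p m) (mulHaar p) ↔
      IntegrableOn (fun x => ‖x‖⁻¹ * f x) (E p m) (addHaar p) := by
    rw [IntegrableOn, mulHaar, restrict_withDensity measurableSet_E,
      integrable_withDensity_iff_integrable_smul' (by fun_prop) (by simp)]
    simp [IntegrableOn]
  refine hdensity.trans
    ⟨fun h => ?_, fun h => h.continuousOn_mul continuousOn_norm_inv_E isCompact_E⟩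
  refine (h.continuousOn_mul continuous_norm.continuousOn isCompact_E).congr_fun (fun x hx => ?_)
    measurableSet_E
  exact mul_inv_cancel_left₀ (norm_pos_of_mem_E hx).ne' _

theorem mulHaar_real_E : (mulHaar p).real (E p m) = m * (1 - (p : ℝ)⁻¹) := by
  calc (mulHaar p).real (E p m) = ∫ z in E p m, ‖z‖⁻¹ ∂addHaar p := by
        simpa using setIntegral_mulHaar (p := p) (m := m) fun _ => 1
    _ = (1 - (p : ℝ)⁻¹) * ∑ a ∈ normValues p m, a * a⁻¹ := setIntegral_E_norm fun a => a⁻¹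
    _ = m * (1 - (p : ℝ)⁻¹) := by
        rw [normValues, Finset.sum_image inv_prime_pow_injective.injOn,
          Finset.sum_congr rfl fun i _ => mul_inv_cancel₀ (inv_prime_pow_pos i).ne']
        simp [mul_comm]

end FundamentalDomain

section Integration

variable {α : Type*} [MeasurableSpace α] {μ : Measure α}

theorem integrable_and_hasSum_integral {F : ℕ → α → ℝ} {f : α → ℝ} (hF : ∀ k, Integrable (F k) μ)
    (hsum : Summable fun k => ∫ a, ‖F k a‖ ∂μ) (hf : ∀ᵐ a ∂μ, HasSum (F · a) (f a)) :
    Integrable f μ ∧ HasSum (fun k => ∫ a, F k a ∂μ) (∫ a, f a ∂μ) := by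
  have htsum : f =ᵐ[μ] fun a => ∑' k, F k a := hf.mono fun a ha => ha.tsum_eq.symm
  refine ⟨⟨?_, ?_⟩, ?_⟩
  · exact aestronglyMeasurable_of_tendsto_ae atTop
      (fun n => Finset.aestronglyMeasurable_fun_sum (Finset.range n) fun k _ => (hF k).1)
      (hf.mono fun a ha => ha.tendsto_sum_nat)
  · calc ∫⁻ a, ‖f a‖ₑ ∂μ ≤ ∫⁻ a, ∑' k, ‖F k a‖ₑ ∂μ :=
          lintegral_mono_ae (htsum.mono fun a ha => ha ▸ enorm_tsum_le_tsum_enorm)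
      _ = ∑' k, ENNReal.ofReal (∫ a, ‖F k a‖ ∂μ) := by
          rw [lintegral_tsum fun k => (hF k).1.enorm]
          exact tsum_congr fun k => (ofReal_integral_norm_eq_lintegral_enorm (hF k)).symm
      _ < ⊤ := hsum.tsum_ofReal_lt_top
  · rw [integral_congr_ae htsum]
    exact hasSum_integral_of_summable_integral_norm hF hsum

theorem integrable_div_sq_of_eq_zero {f r : α → ℝ} {ε : ℝ} (hf : Integrable f μ)
    (hr : Measurable r) (hε : 0 < ε) (h0 : ∀ᵐ a ∂μ, r a < ε → f a = 0) :
    Integrable (fun a => f a / r a ^ 2) μ := by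
  have hbound : Integrable (fun a => (max ε (r a) ^ 2)⁻¹ * f a) μ := by
    refine hf.bdd_mul (c := (ε ^ 2)⁻¹) (by fun_prop) (Eventually.of_forall fun a => ?_)
    rw [Real.norm_of_nonneg (by positivity)]
    gcongr
    exact le_max_left _ _
  refine hbound.congr (h0.mono fun a ha => ?_)
  rcases lt_or_ge (r a) ε with h | h
  · simp [ha h]
  · simp [max_eq_right h, div_eq_inv_mul]

end Integration

section NormalizedDistance

theorem d_nonneg (x y : ℚ_[p]) : 0 ≤ d p x y := by
  unfold d
  positivity

theorem d_le_one (x y : ℚ_[p]) : d p x y ≤ 1 :=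
  div_le_one_of_le₀ (norm_sub_le_max x y) (le_max_of_le_left (norm_nonneg x))

theorem d_eq_div_max_norm_sub (x y : ℚ_[p]) : d p x y = ‖x - y‖ / max ‖x - y‖ ‖y‖ := by
  have hx : ‖x‖ ≤ max ‖x - y‖ ‖y‖ := by
    simpa only [sub_neg_eq_add, sub_add_cancel, norm_neg] using norm_sub_le_max (x - y) (-y)
  rw [d, le_antisymm (max_le hx (le_max_right _ _))
    (max_le (norm_sub_le_max x y) (le_max_right _ _))]

theorem d_eq_of_norm_sub_lt {x y z : ℚ_[p]} (h : ‖z - x‖ < ‖x - y‖) : d p z y = d p x y := by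
  rw [d_eq_div_max_norm_sub, norm_sub_eq_of_norm_sub_lt h, ← d_eq_div_max_norm_sub]

theorem d_of_norm_eq {x y : ℚ_[p]} (h : ‖x‖ = ‖y‖) : d p x y = ‖x - y‖ / ‖y‖ := by
  rw [d, h, max_self]

theorem d_of_norm_ne {x y : ℚ_[p]} (h : ‖x‖ ≠ ‖y‖) : d p x y = 1 := by
  rw [d, norm_sub_eq_max_of_norm_ne h]
  exact div_self (h.lt_or_gt.elim (fun h => lt_max_of_lt_right ((norm_nonneg x).trans_lt h))
    fun h => lt_max_of_lt_left ((norm_nonneg y).trans_lt h)).ne'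

theorem norm_eq_of_d_lt_one {x y : ℚ_[p]} (h : d p x y < 1) : ‖x‖ = ‖y‖ :=
  not_ne_iff.1 fun hne => h.ne (d_of_norm_ne hne)

theorem exists_d_eq_inv_prime_pow {x y : ℚ_[p]} (hxy : x ≠ y) :
    ∃ j : ℕ, d p x y = (p : ℝ)⁻¹ ^ j := by
  by_cases h : ‖x‖ = ‖y‖
  · have hy : y ≠ 0 := by
      rintro rfl
      exact hxy (by simpa using h)
    have hd : d p x y = ‖(x - y) / y‖ := by rw [d_of_norm_eq h, norm_div]
    rw [hd]
    exact exists_norm_eq_inv_prime_pow (div_ne_zero (sub_ne_zero.2 hxy) hy) (hd ▸ d_le_one x y)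
  · exact ⟨0, by rw [d_of_norm_ne h, pow_zero]⟩

theorem setOf_d_le_eq_closedBall {y : ℚ_[p]} (hy : y ≠ 0) (k : ℕ) :
    {z | d p z y ≤ (p : ℝ)⁻¹ ^ (k + 1)} = closedBall y (‖y‖ * (p : ℝ)⁻¹ ^ (k + 1)) := by
  have hlt : (p : ℝ)⁻¹ ^ (k + 1) < 1 :=
    pow_lt_one₀ inv_prime_pos.le inv_prime_lt_one k.succ_ne_zero
  have hy0 : 0 < ‖y‖ := norm_pos_iff.2 hy
  ext z
  simp only [Set.mem_ofPred_eq, mem_closedBall, dist_eq_norm]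
  constructor
  · intro h
    rwa [d_of_norm_eq (norm_eq_of_d_lt_one (h.trans_lt hlt)), div_le_iff₀' hy0] at h
  · intro h
    rwa [d_of_norm_eq (norm_eq_of_norm_sub_lt (h.trans_lt (mul_lt_of_lt_one_right hy0 hlt))),
      div_le_iff₀' hy0]

end NormalizedDistance

section LaplacianOfBall

variable {m : ℕ} {x y : ℚ_[p]}

theorem dConverges_of_const_near {f : ℚ_[p] → ℝ} {ε : ℝ} (hf : IntegrableOn f (E p m) (addHaar p))
    (hε : 0 < ε) (hconst : ∀ z, ‖z - x‖ < ε → f z = f x) : DConverges p m f x :=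
  (integrable_div_sq_of_eq_zero (hf.sub (integrable_const (f x))) (by fun_prop) hε
    (Eventually.of_forall fun z hz => sub_eq_zero.2 (hconst z hz))).mul_const ‖x‖

theorem setIntegral_closedBall_inv_sq_norm_sub (hx : x ∈ E p m) :
    ∫ z in closedBall 0 ((p : ℝ)⁻¹ ^ m), (‖z - x‖ ^ 2)⁻¹ ∂addHaar p =
      (p : ℝ)⁻¹ ^ m / ‖x‖ ^ 2 := by
  have hnorm : Set.EqOn (fun z => (‖z - x‖ ^ 2)⁻¹) (fun _ => (‖x‖ ^ 2)⁻¹)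
      (closedBall 0 ((p : ℝ)⁻¹ ^ m)) := fun z hz => by
    have hlt : ‖z‖ < ‖x‖ := (mem_closedBall_zero_iff.1 hz).trans_lt
      (inv_prime_pow_lt_norm_of_mem_E hx)
    simp only [norm_sub_eq_max_of_norm_ne hlt.ne, max_eq_right hlt.le]
  rw [setIntegral_congr_fun isClosed_closedBall.measurableSet hnorm, setIntegral_const,
    addHaar_real_closedBall, smul_eq_mul, div_eq_mul_inv]

theorem setIntegral_annulus_inv_sq_norm_sub (x : ℚ_[p]) (n : ℕ) :
    ∫ z in closedBall x 1 \ closedBall x ((p : ℝ)⁻¹ ^ n), (‖z - x‖ ^ 2)⁻¹ ∂addHaar p =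
      (p : ℝ)⁻¹ * ((p : ℝ) ^ n - 1) := by
  have hp := cast_prime_pos (p := p)
  rw [setIntegral_closedBall_diff_closedBall x n fun t => (t ^ 2)⁻¹, ← mul_geom_sum, ← mul_assoc]
  congr 1
  · field_simp
  · refine Finset.sum_congr rfl fun i _ => ?_
    simp only [inv_pow]
    field_simp

theorem E_diff_closedBall_eq (hx : x ∈ E p m) (n : ℕ) :
    E p m \ closedBall x ((p : ℝ)⁻¹ ^ n) =
      (closedBall x 1 \ closedBall x ((p : ℝ)⁻¹ ^ n)) \ closedBall 0 ((p : ℝ)⁻¹ ^ m) := by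
  rw [E_eq_diff, IsUltrametricDist.closedBall_eq_of_mem
    (mem_closedBall_zero_iff.2 (norm_le_one_of_mem_E hx)), Set.sdiff_sdiff_comm]

theorem setIntegral_E_diff_closedBall_inv_sq_norm_sub (hx : x ∈ E p m) {n : ℕ}
    (hn : (p : ℝ)⁻¹ ^ n < ‖x‖) :
    ∫ z in E p m \ closedBall x ((p : ℝ)⁻¹ ^ n), (‖z - x‖ ^ 2)⁻¹ ∂addHaar p =
      (p : ℝ)⁻¹ * ((p : ℝ) ^ n - 1) - (p : ℝ)⁻¹ ^ m / ‖x‖ ^ 2 := by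
  have hpos : ∀ z ∉ closedBall x ((p : ℝ)⁻¹ ^ n), 0 < ‖z - x‖ := fun z hz =>
    (inv_prime_pow_pos n).trans (by simpa [dist_eq_norm] using hz)
  have hcompact : IsCompact (closedBall x 1 \ closedBall x ((p : ℝ)⁻¹ ^ n)) :=
    (isCompact_closedBall x 1).diff (isClopen_closedBall_inv_prime_pow x n).isOpen
  have hsubset : closedBall 0 ((p : ℝ)⁻¹ ^ m) ⊆ closedBall x 1 \ closedBall x ((p : ℝ)⁻¹ ^ n) := by
    intro z hz
    have hlt : ‖z‖ < ‖x‖ := (mem_closedBall_zero_iff.1 hz).trans_lt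
      (inv_prime_pow_lt_norm_of_mem_E hx)
    simp only [Set.mem_sdiff, mem_closedBall, dist_eq_norm, norm_sub_eq_max_of_norm_ne hlt.ne,
      max_eq_right hlt.le, not_le]
    exact ⟨norm_le_one_of_mem_E hx, hn⟩
  have hint : IntegrableOn (fun z => (‖z - x‖ ^ 2)⁻¹)
      (closedBall x 1 \ closedBall x ((p : ℝ)⁻¹ ^ n)) (addHaar p) :=
    ContinuousOn.integrableOn_compact hcompact <| by
      refine ContinuousOn.inv₀ (by fun_prop) fun z hz => ?_
      exact (pow_pos (hpos z hz.2) 2).ne'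
  rw [E_diff_closedBall_eq hx, setIntegral_sdiff isClosed_closedBall.measurableSet hint hsubset,
    setIntegral_annulus_inv_sq_norm_sub, setIntegral_closedBall_inv_sq_norm_sub hx]

theorem D_indicator_closedBall_self (hx : x ∈ E p m) (k : ℕ) :
    D p m ((closedBall x (‖x‖ * (p : ℝ)⁻¹ ^ (k + 1))).indicator 1) x =
      -((p : ℝ)⁻¹ * ((p : ℝ) ^ (k + 1) - U p m x)) := by
  obtain ⟨s, -, hs⟩ := exists_norm_eq_of_mem_E hx
  have hp := cast_prime_pos (p := p)
  set β := closedBall x (‖x‖ * (p : ℝ)⁻¹ ^ (k + 1)) with hβ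
  have hβm : MeasurableSet β := isClosed_closedBall.measurableSet
  have hxβ : x ∈ β := mem_closedBall_self (by positivity)
  have hkernel : kernelD p (β.indicator 1) x = βᶜ.indicator fun z => (‖z - x‖ ^ 2)⁻¹ * -‖x‖ := by
    ext z
    by_cases hz : z ∈ β <;> simp [kernelD, hxβ, hz, div_eq_inv_mul]
  have hradius : ‖x‖ * (p : ℝ)⁻¹ ^ (k + 1) = (p : ℝ)⁻¹ ^ (s + k + 1) := by
    rw [hs, ← pow_add, add_assoc]
  rw [D, hkernel, setIntegral_indicator hβm.compl, ← Set.sdiff_eq, integral_mul_const, hβ, hradius,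
    setIntegral_E_diff_closedBall_inv_sq_norm_sub hx
      (by rw [hs]; exact inv_prime_pow_lt_iff.2 (by lia)), U, hs,
    zpow_sub₀ hp.ne', zpow_one, zpow_natCast]
  simp only [inv_pow]
  field_simp
  ring

theorem D_indicator_closedBall_of_notMem {r : ℝ} (hx : x ∉ closedBall y r)
    (hsub : closedBall y r ⊆ E p m) :
    D p m ((closedBall y r).indicator 1) x =
      ‖x‖ * (addHaar p).real (closedBall y r) / ‖x - y‖ ^ 2 := by
  have hkernel : kernelD p ((closedBall y r).indicator 1) x =
      (closedBall y r).indicator fun _ => ‖x‖ / ‖x - y‖ ^ 2 := by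
    ext z
    by_cases hz : z ∈ closedBall y r
    · have hlt : ‖z - y‖ < ‖y - x‖ := by
        simp only [mem_closedBall, dist_eq_norm, not_le] at hx hz
        exact hz.trans_lt (norm_sub_rev x y ▸ hx)
      simp [kernelD, hx, hz, norm_sub_eq_of_norm_sub_lt hlt, norm_sub_rev x y, div_eq_inv_mul]
    · simp [kernelD, hx, hz]
  rw [D, hkernel, setIntegral_indicator isClosed_closedBall.measurableSet,
    Set.inter_eq_right.2 hsub, setIntegral_const, smul_eq_mul]
  ring

end LaplacianOfBall

section LayerCake

variable {m : ℕ} {x y : ℚ_[p]}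

/-- The indicator function of the `k`-th layer `{z | d(z, y) ≤ p^(-k-1)}`, a ball about `y`. The
functions of `d(·, y)` are the series in these indicators whose coefficients are the increments of
the profile. -/
noncomputable def layer (k : ℕ) (y : ℚ_[p]) : ℚ_[p] → ℝ :=
  {z | d p z y ≤ (p : ℝ)⁻¹ ^ (k + 1)}.indicator 1

/-- The value of `D` on the `k`-th layer about `y`, as a function of `u = U(y)` and `t = d(x, y)`,
up to the factor `p^(-|v(x) - v(y)|)`. -/
noncomputable def layerWeight (p k : ℕ) (u t : ℝ) : ℝ :=
  if t ≤ (p : ℝ)⁻¹ ^ (k + 1) then -((p : ℝ)⁻¹ * ((p : ℝ) ^ (k + 1) - u))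
  else (p : ℝ)⁻¹ ^ (k + 1) / t ^ 2

theorem exists_norm_mul_inv_prime_pow_eq (hy : y ∈ E p m) (k : ℕ) :
    ∃ n : ℕ, ‖y‖ * (p : ℝ)⁻¹ ^ k = (p : ℝ)⁻¹ ^ n := by
  obtain ⟨s, -, hs⟩ := exists_norm_eq_of_mem_E hy
  exact ⟨s + k, by rw [hs, pow_add]⟩

theorem layer_eq_indicator_closedBall (hy : y ≠ 0) (k : ℕ) :
    layer k y = (closedBall y (‖y‖ * (p : ℝ)⁻¹ ^ (k + 1))).indicator 1 := by
  rw [layer, setOf_d_le_eq_closedBall hy]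

theorem norm_mul_inv_prime_pow_succ_lt (hy : y ≠ 0) (k : ℕ) :
    ‖y‖ * (p : ℝ)⁻¹ ^ (k + 1) < ‖y‖ :=
  mul_lt_of_lt_one_right (norm_pos_iff.2 hy)
    (pow_lt_one₀ inv_prime_pos.le inv_prime_lt_one k.succ_ne_zero)

theorem closedBall_subset_E {r : ℝ} (hy : y ∈ E p m) (hr : r < ‖y‖) : closedBall y r ⊆ E p m :=
  fun z hz => mem_E_of_norm_eq
    (norm_eq_of_norm_sub_lt ((dist_eq_norm z y ▸ mem_closedBall.1 hz).trans_lt hr)) hy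

theorem D_layer (hx : x ∈ E p m) (hy : y ∈ E p m) (k : ℕ) :
    D p m (layer k y) x =
      min ‖x‖ ‖y‖ / max ‖x‖ ‖y‖ * layerWeight p k (U p m y) (d p x y) := by
  have hx0 := norm_pos_of_mem_E hx
  have hy0 := norm_pos_of_mem_E hy
  have hball := setOf_d_le_eq_closedBall (norm_pos_iff.1 hy0) k
  rw [layer_eq_indicator_closedBall (norm_pos_iff.1 hy0), layerWeight]
  split_ifs with h
  · have hmem : x ∈ closedBall y (‖y‖ * (p : ℝ)⁻¹ ^ (k + 1)) := hball ▸ h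
    have hxy : ‖x‖ = ‖y‖ := norm_eq_of_d_lt_one
      (h.trans_lt (pow_lt_one₀ inv_prime_pos.le inv_prime_lt_one k.succ_ne_zero))
    rw [IsUltrametricDist.closedBall_eq_of_mem hmem, ← hxy, D_indicator_closedBall_self hx, U, U,
      hxy, min_self, max_self, div_self hy0.ne', one_mul]
  · have hnotMem : x ∉ closedBall y (‖y‖ * (p : ℝ)⁻¹ ^ (k + 1)) := hball ▸ h
    obtain ⟨n, hn⟩ := exists_norm_mul_inv_prime_pow_eq hy (k + 1)
    rw [D_indicator_closedBall_of_notMem hnotMem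
      (closedBall_subset_E hy (norm_mul_inv_prime_pow_succ_lt (norm_pos_iff.1 hy0) k)), hn,
      addHaar_real_closedBall, ← hn, d]
    have : 0 < max ‖x‖ ‖y‖ := lt_max_of_lt_left hx0
    field_simp
    rw [← min_mul_max ‖x‖ ‖y‖]
    ring

theorem dConverges_layer (hy : y ∈ E p m) (k : ℕ) : DConverges p m (layer k y) x := by
  have hy0 := norm_pos_of_mem_E hy
  rw [layer_eq_indicator_closedBall (norm_pos_iff.1 hy0)]
  have hr : 0 < ‖y‖ * (p : ℝ)⁻¹ ^ (k + 1) := mul_pos hy0 (inv_prime_pow_pos _)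
  refine dConverges_of_const_near
    ((integrable_const 1).indicator isClosed_closedBall.measurableSet) hr fun z hz => ?_
  have hiff : z ∈ closedBall y (‖y‖ * (p : ℝ)⁻¹ ^ (k + 1)) ↔
      x ∈ closedBall y (‖y‖ * (p : ℝ)⁻¹ ^ (k + 1)) := by
    have hzx : dist z x ≤ ‖y‖ * (p : ℝ)⁻¹ ^ (k + 1) := dist_eq_norm z x ▸ hz.le
    exact ⟨fun h => (dist_triangle_max x z y).trans (max_le (dist_comm z x ▸ hzx) h),
      fun h => (dist_triangle_max z x y).trans (max_le hzx h)⟩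
  exact Set.indicator_const_eq_indicator_const hiff

theorem hasSum_layer {f : ℝ → ℝ} {z : ℚ_[p]} (hzy : z ≠ y) :
    HasSum (fun k => (f ((p : ℝ)⁻¹ ^ (k + 1)) - f ((p : ℝ)⁻¹ ^ k)) * layer k y z)
      (f (d p z y) - f 1) := by
  obtain ⟨j, hj⟩ := exists_d_eq_inv_prime_pow hzy
  have hlayer : ∀ k, layer k y z = if k < j then 1 else 0 := fun k => by
    simp only [layer, Set.indicator_apply, Set.mem_ofPred_eq, hj, inv_prime_pow_le_iff,
      Nat.add_one_le_iff, Pi.one_apply]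
  have hsum := Finset.sum_range_sub (fun k => f ((p : ℝ)⁻¹ ^ k)) j
  rw [pow_zero, ← hj] at hsum
  rw [← hsum]
  simp only [hlayer, mul_ite, mul_one, mul_zero]
  rw [← Finset.sum_congr rfl fun k hk => if_pos (Finset.mem_range.1 hk)]
  exact hasSum_sum_of_ne_finset_zero fun k hk => if_neg (by simpa using hk)

theorem kernelD_layer_nonneg {k : ℕ} (hx : (p : ℝ)⁻¹ ^ (k + 1) < d p x y) (z : ℚ_[p]) :
    0 ≤ kernelD p (layer k y) x z := by
  have h0 : layer k y x = 0 := Set.indicator_of_notMem (by simpa using hx) _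
  rw [kernelD, h0, sub_zero]
  have : 0 ≤ layer k y z := Set.indicator_nonneg (fun _ _ => zero_le_one) _
  positivity

theorem summable_integral_norm_kernelD_layer (hx : x ∈ E p m) (hy : y ∈ E p m)
    (hxy : x ≠ y) : Summable fun k => ∫ z in E p m, ‖kernelD p (layer k y) x z‖ ∂addHaar p := by
  have hd : 0 < d p x y := by
    obtain ⟨j, hj⟩ := exists_d_eq_inv_prime_pow hxy
    exact hj ▸ inv_prime_pow_pos j
  have hgeom : Summable fun k : ℕ =>
      min ‖x‖ ‖y‖ / max ‖x‖ ‖y‖ * ((p : ℝ)⁻¹ ^ (k + 1) / d p x y ^ 2) :=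
    (((summable_nat_add_iff 1).2 (summable_geometric_of_lt_one inv_prime_pos.le
      inv_prime_lt_one)).div_const _).mul_left _
  refine hgeom.of_norm_bounded_eventually_nat ?_
  have htendsto := (tendsto_add_atTop_iff_nat 1).2 (tendsto_inv_prime_pow (p := p))
  filter_upwards [htendsto.eventually_lt_const hd] with k hk
  rw [integral_congr_ae (Eventually.of_forall fun z =>
    Real.norm_of_nonneg (kernelD_layer_nonneg hk z)), ← D, D_layer hx hy, layerWeight,
    if_neg hk.not_ge, Real.norm_of_nonneg (by positivity)]

theorem dConverges_and_hasSum_D_comp_d {f : ℝ → ℝ} {M : ℝ}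
    (hf : ∀ k, |f ((p : ℝ)⁻¹ ^ (k + 1)) - f ((p : ℝ)⁻¹ ^ k)| ≤ M)
    (hx : x ∈ E p m) (hy : y ∈ E p m) (hxy : x ≠ y) :
    DConverges p m (fun z => f (d p z y)) x ∧
      HasSum (fun k => (f ((p : ℝ)⁻¹ ^ (k + 1)) - f ((p : ℝ)⁻¹ ^ k)) * D p m (layer k y) x)
        (D p m (fun z => f (d p z y)) x) := by
  have hint : ∀ k, Integrable (fun z => (f ((p : ℝ)⁻¹ ^ (k + 1)) - f ((p : ℝ)⁻¹ ^ k)) *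
      kernelD p (layer k y) x z) ((addHaar p).restrict (E p m)) := fun k =>
    (dConverges_layer hy k).const_mul _
  have hsummable : Summable fun k => ∫ z in E p m, ‖(f ((p : ℝ)⁻¹ ^ (k + 1)) - f ((p : ℝ)⁻¹ ^ k)) *
      kernelD p (layer k y) x z‖ ∂addHaar p := by
    simp_rw [norm_mul, integral_const_mul]
    refine ((summable_integral_norm_kernelD_layer hx hy hxy).mul_left M).of_nonneg_of_le
      (fun k => by positivity) fun k => ?_
    gcongr
    exact hf k
  have hpointwise : ∀ᵐ z ∂(addHaar p).restrict (E p m),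
      HasSum (fun k => (f ((p : ℝ)⁻¹ ^ (k + 1)) - f ((p : ℝ)⁻¹ ^ k)) * kernelD p (layer k y) x z)
        (kernelD p (fun z => f (d p z y)) x z) := by
    filter_upwards [compl_mem_ae_iff.2 (measure_singleton y)] with z hz
    have hsub := (((hasSum_layer (f := f) hz).sub (hasSum_layer (f := f) hxy)).div_const
      (‖z - x‖ ^ 2)).mul_right ‖x‖
    rw [sub_sub_sub_cancel_right] at hsub
    convert! hsub using 2 with k
    simp only [kernelD]
    ring
  simpa only [integral_const_mul] using! integrable_and_hasSum_integral hint hsummable hpointwise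

end LayerCake

section Coefficients

variable {m : ℕ} {y : ℚ_[p]}

theorem lambda0_pos : 0 < lambda0 p := by
  have hp0 := cast_prime_pos (p := p)
  have hp1 : 0 < (p : ℝ) - 1 := sub_pos.2 one_lt_cast_prime
  unfold lambda0
  positivity

/-- The ratio `U(y) / (p + 1)`, to whose `n`-th power `λ_n(y)` is comparable. -/
noncomputable def ratio (p : ℕ) [Fact p.Prime] (m : ℕ) (y : ℚ_[p]) : ℝ := U p m y / ((p : ℝ) + 1)

theorem ratio_nonneg : 0 ≤ ratio p m y := by
  unfold ratio U
  positivity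

theorem U_le_two (hy : y ∈ E p m) : U p m y ≤ 2 := by
  obtain ⟨s, hs, hys⟩ := exists_norm_eq_of_mem_E hy
  have hp : 1 ≤ (p : ℝ) := one_lt_cast_prime.le
  have hsnd : (p : ℝ) ^ (1 - (m : ℤ)) * ‖y‖⁻¹ ≤ 1 := by
    rw [hys, inv_pow, inv_inv, ← zpow_natCast, ← zpow_add₀ cast_prime_pos.ne']
    exact zpow_le_one_of_nonpos₀ hp (by lia)
  rw [U]
  linarith [norm_le_one_of_mem_E hy]

theorem ratio_lt_one (hy : y ∈ E p m) : ratio p m y < 1 := by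
  have hp := one_lt_cast_prime (p := p)
  rw [ratio, div_lt_one (by positivity)]
  linarith [U_le_two hy]

theorem lambda_mul_one_sub (n : ℕ) :
    lambda p m (n + 1) y * (1 - (p : ℝ)⁻¹ ^ (n + 1)) =
      lambda0 p / ((p : ℝ) - 1) *
        (p * ratio p m y ^ (n + 1) - (ratio p m y * (p : ℝ)⁻¹) ^ (n + 1)) := by
  have hp0 := cast_prime_pos (p := p)
  have hp1 : (p : ℝ) - 1 ≠ 0 := (sub_pos.2 one_lt_cast_prime).ne'
  have hpow : (p : ℝ) ^ (n + 1) - 1 ≠ 0 :=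
    (sub_pos.2 (one_lt_pow₀ one_lt_cast_prime n.succ_ne_zero)).ne'
  rw [lambda, ratio, mul_pow, div_pow, inv_pow]
  field_simp
  ring

theorem lambda_nonneg (n : ℕ) : 0 ≤ lambda p m (n + 1) y := by
  have hp1 : 0 < (p : ℝ) - 1 := sub_pos.2 one_lt_cast_prime
  have hpow : ∀ n : ℕ, 0 < (p : ℝ) ^ (n + 1) - 1 := fun n =>
    sub_pos.2 (one_lt_pow₀ one_lt_cast_prime n.succ_ne_zero)
  have hnum := hpow (n + 1)
  have hden := hpow n
  have hlam := lambda0_pos (p := p)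
  have hU : 0 ≤ U p m y := by
    unfold U
    positivity
  unfold lambda
  positivity

theorem lambda_le (n : ℕ) :
    lambda p m (n + 1) y ≤
      lambda0 p / ((p : ℝ) - 1) * p * (1 - (p : ℝ)⁻¹)⁻¹ * ratio p m y ^ (n + 1) := by
  have hp1 : 0 < (p : ℝ) - 1 := sub_pos.2 one_lt_cast_prime
  have hq : 0 < 1 - (p : ℝ)⁻¹ := sub_pos.2 inv_prime_lt_one
  have hlam := lambda0_pos (p := p)
  have hr := ratio_nonneg (p := p) (m := m) (y := y)
  suffices h : lambda p m (n + 1) y * (1 - (p : ℝ)⁻¹) ≤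
      lambda0 p / ((p : ℝ) - 1) * (p * ratio p m y ^ (n + 1)) by
    calc lambda p m (n + 1) y
        ≤ lambda0 p / ((p : ℝ) - 1) * (p * ratio p m y ^ (n + 1)) / (1 - (p : ℝ)⁻¹) :=
          (le_div_iff₀ hq).2 h
      _ = _ := by ring
  calc lambda p m (n + 1) y * (1 - (p : ℝ)⁻¹)
      ≤ lambda p m (n + 1) y * (1 - (p : ℝ)⁻¹ ^ (n + 1)) := by
        gcongr
        · exact lambda_nonneg n
        · exact pow_le_of_le_one inv_prime_pos.le inv_prime_lt_one.le n.succ_ne_zero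
    _ ≤ lambda0 p / ((p : ℝ) - 1) * (p * ratio p m y ^ (n + 1)) := by
        rw [lambda_mul_one_sub]
        gcongr
        exact sub_le_self _ (by positivity)

theorem summable_lambda (hy : y ∈ E p m) : Summable fun n : ℕ => lambda p m (n + 1) y :=
  (((summable_nat_add_iff 1).2 (summable_geometric_of_lt_one ratio_nonneg
    (ratio_lt_one hy))).mul_left _).of_nonneg_of_le lambda_nonneg lambda_le

theorem summable_lambda_mul_pow (hy : y ∈ E p m) {t : ℝ} (h0 : 0 ≤ t) (h1 : t ≤ 1) :
    Summable fun n : ℕ => lambda p m (n + 1) y * t ^ (n + 1) :=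
  (summable_lambda hy).of_nonneg_of_le (fun n => mul_nonneg (lambda_nonneg n) (pow_nonneg h0 _))
    fun n => mul_le_of_le_one_right (lambda_nonneg n) (pow_le_one₀ h0 h1)

end Coefficients

section Profile

variable {m : ℕ} {y : ℚ_[p]}

/-- The function of `t = d(x, y)` through which `B(x, y)` depends on `x`. -/
noncomputable def profile (p : ℕ) [Fact p.Prime] (m : ℕ) (y : ℚ_[p]) (t : ℝ) : ℝ :=
  A p m y + lambda0 p * Real.logb p t + ∑' n : ℕ, lambda p m (n + 1) y * t ^ (n + 1)

theorem logb_inv_prime_mul {t : ℝ} (ht : t ≠ 0) :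
    Real.logb p ((p : ℝ)⁻¹ * t) = Real.logb p t - 1 := by
  rw [Real.logb_mul inv_prime_pos.ne' ht, Real.logb_inv,
    Real.logb_self_eq_one one_lt_cast_prime, neg_add_eq_sub]

theorem ratio_mul_lt_one (hy : y ∈ E p m) {t : ℝ} (ht : t ≤ 1) : ratio p m y * t < 1 :=
  (mul_le_of_le_one_right ratio_nonneg ht).trans_lt (ratio_lt_one hy)

theorem tsum_lambda_mul_pow_sub (hy : y ∈ E p m) {t : ℝ} (h0 : 0 ≤ t) (h1 : t ≤ 1) :
    ∑' n : ℕ, lambda p m (n + 1) y * t ^ (n + 1) -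
        ∑' n : ℕ, lambda p m (n + 1) y * ((p : ℝ)⁻¹ * t) ^ (n + 1) =
      lambda0 p / ((1 - ratio p m y * t) * (1 - ratio p m y * ((p : ℝ)⁻¹ * t))) - lambda0 p := by
  have hqt0 : 0 ≤ (p : ℝ)⁻¹ * t := mul_nonneg inv_prime_pos.le h0
  have hqt1 : (p : ℝ)⁻¹ * t ≤ 1 := mul_le_one₀ inv_prime_lt_one.le h0 h1
  have ht := ratio_mul_lt_one hy h1
  have hqt := ratio_mul_lt_one hy hqt1
  have hgeom : ∀ s : ℝ, 0 ≤ s → s < 1 → HasSum (fun n : ℕ => s ^ (n + 1)) (s * (1 - s)⁻¹) :=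
    fun s hs0 hs1 => by
      simpa only [pow_succ'] using (hasSum_geometric_of_lt_one hs0 hs1).mul_left s
  have hterm : ∀ n : ℕ, lambda p m (n + 1) y * t ^ (n + 1) -
      lambda p m (n + 1) y * ((p : ℝ)⁻¹ * t) ^ (n + 1) = lambda0 p / ((p : ℝ) - 1) *
        (p * (ratio p m y * t) ^ (n + 1) -
          (ratio p m y * ((p : ℝ)⁻¹ * t)) ^ (n + 1)) := fun n => by
    linear_combination t ^ (n + 1) * lambda_mul_one_sub (p := p) (m := m) (y := y) n
  have hsum := (((hgeom _ (mul_nonneg ratio_nonneg h0) ht).mul_left (p : ℝ)).sub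
    (hgeom _ (mul_nonneg ratio_nonneg hqt0) hqt)).mul_left (lambda0 p / ((p : ℝ) - 1))
  rw [((summable_lambda_mul_pow hy h0 h1).hasSum.sub
    (summable_lambda_mul_pow hy hqt0 hqt1).hasSum).unique (hsum.congr_fun hterm)]
  have hp0 := cast_prime_pos (p := p)
  have hp1 : (p : ℝ) - 1 ≠ 0 := (sub_pos.2 one_lt_cast_prime).ne'
  have ht' : 1 - ratio p m y * t ≠ 0 := (sub_pos.2 ht).ne'
  have hqt' : (p : ℝ) - ratio p m y * t ≠ 0 := fun h =>
    (sub_pos.2 hqt).ne' (by field_simp; linarith)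
  field_simp
  ring

theorem profile_inv_prime_mul_sub (hy : y ∈ E p m) {t : ℝ} (h0 : 0 < t) (h1 : t ≤ 1) :
    profile p m y ((p : ℝ)⁻¹ * t) - profile p m y t =
      -(lambda0 p / ((1 - ratio p m y * t) * (1 - ratio p m y * ((p : ℝ)⁻¹ * t)))) := by
  rw [profile, profile, logb_inv_prime_mul h0.ne']
  linear_combination -tsum_lambda_mul_pow_sub hy h0.le h1

end Profile

section LaplacianOfB

variable {m : ℕ} {x y : ℚ_[p]}

theorem dConverges_logb_d (hx : x ∈ E p m) (hy : y ∈ E p m) (hxy : x ≠ y) :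
    DConverges p m (fun z => Real.logb p (d p z y)) x :=
  (dConverges_and_hasSum_D_comp_d (M := 1) (fun k => by
    rw [pow_succ', logb_inv_prime_mul (inv_prime_pow_pos k).ne', sub_sub_cancel_left, abs_neg,
      abs_one]) hx hy hxy).1

theorem dConverges_d_pow (hx : x ∈ E p m) (hy : y ∈ E p m) (hxy : x ≠ y) (n : ℕ) :
    DConverges p m (fun z => d p z y ^ n) x :=
  have hmem : ∀ k : ℕ, ((p : ℝ)⁻¹ ^ k) ^ n ∈ Set.Icc 0 1 := fun k =>
    ⟨pow_nonneg (inv_prime_pow_pos k).le n, pow_le_one₀ (inv_prime_pow_pos k).le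
      (inv_prime_pow_le_one k)⟩
  (dConverges_and_hasSum_D_comp_d (f := fun t => t ^ n) (M := 1 - 0) (fun _ =>
    abs_sub_le_of_le_of_le (hmem _).1 (hmem _).2 (hmem _).1 (hmem _).2) hx hy hxy).1

theorem profile_inv_prime_pow_succ_sub (hy : y ∈ E p m) (k : ℕ) :
    profile p m y ((p : ℝ)⁻¹ ^ (k + 1)) - profile p m y ((p : ℝ)⁻¹ ^ k) =
      -(lambda0 p / ((1 - ratio p m y * (p : ℝ)⁻¹ ^ k) *
        (1 - ratio p m y * (p : ℝ)⁻¹ ^ (k + 1)))) := by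
  simpa only [pow_succ'] using
    profile_inv_prime_mul_sub hy (inv_prime_pow_pos k) (inv_prime_pow_le_one k)

theorem abs_profile_inv_prime_pow_succ_sub_le (hy : y ∈ E p m) (k : ℕ) :
    |profile p m y ((p : ℝ)⁻¹ ^ (k + 1)) - profile p m y ((p : ℝ)⁻¹ ^ k)| ≤
      lambda0 p / ((1 - ratio p m y) * (1 - ratio p m y)) := by
  have hlam := lambda0_pos (p := p)
  have hr : 0 < 1 - ratio p m y := sub_pos.2 (ratio_lt_one hy)
  have hle : ∀ k, 1 - ratio p m y ≤ 1 - ratio p m y * (p : ℝ)⁻¹ ^ k := fun k =>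
    sub_le_sub_left (mul_le_of_le_one_right ratio_nonneg (inv_prime_pow_le_one k)) 1
  have hpos : ∀ k, 0 < 1 - ratio p m y * (p : ℝ)⁻¹ ^ k := fun k => hr.trans_le (hle k)
  have hk := hpos k
  have hk' := hpos (k + 1)
  rw [profile_inv_prime_pow_succ_sub hy, abs_neg, abs_of_nonneg (by positivity)]
  exact div_le_div_of_nonneg_left hlam.le (mul_pos hr hr)
    (mul_le_mul (hle k) (hle (k + 1)) hr.le hk.le)

/-- The sum over the layers `i ≥ k` about `y` of their contributions to `DB(x, y)`, up to the
factor `p^(-|v(x) - v(y)|)`, as a function of `r = U(y) / (p + 1)` and of `j`, where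
`d(x, y) = p^(-j)`. -/
noncomputable def layerTail (p : ℕ) (r : ℝ) (j k : ℕ) : ℝ :=
  -(lambda0 p / ((p : ℝ) - 1)) *
    ((if k ≤ j then (p : ℝ) ^ k else ((p : ℝ) ^ j) ^ 2 * (p : ℝ)⁻¹ ^ k) / (1 - r * (p : ℝ)⁻¹ ^ k))

theorem profile_sub_mul_layerWeight (hy : y ∈ E p m) (j k : ℕ) :
    (profile p m y ((p : ℝ)⁻¹ ^ (k + 1)) - profile p m y ((p : ℝ)⁻¹ ^ k)) *
        layerWeight p k (U p m y) ((p : ℝ)⁻¹ ^ j) =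
      layerTail p (ratio p m y) j k - layerTail p (ratio p m y) j (k + 1) := by
  have hp0 := cast_prime_pos (p := p)
  have hp1 : (p : ℝ) - 1 ≠ 0 := (sub_pos.2 one_lt_cast_prime).ne'
  have hU : U p m y = ratio p m y * ((p : ℝ) + 1) := by
    rw [ratio]
    field_simp
  have hne : ∀ k, (p : ℝ) ^ k - ratio p m y ≠ 0 := fun k =>
    (sub_pos.2 ((ratio_lt_one hy).trans_le (one_le_pow₀ one_lt_cast_prime.le))).ne'
  have hk := hne k
  have hk' := hne (k + 1)
  rw [profile_inv_prime_pow_succ_sub hy, layerWeight, layerTail, layerTail, hU]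
  simp only [inv_prime_pow_le_iff]
  rcases lt_or_ge k j with h | h
  · rw [if_pos (Nat.succ_le_of_lt h), if_pos h.le, if_pos (Nat.succ_le_of_lt h)]
    simp only [inv_pow]
    field_simp
    ring
  · have hj : (if k ≤ j then (p : ℝ) ^ k else ((p : ℝ) ^ j) ^ 2 * (p : ℝ)⁻¹ ^ k) =
        ((p : ℝ) ^ j) ^ 2 * (p : ℝ)⁻¹ ^ k := by
      split_ifs with hkj
      · rw [le_antisymm hkj h, inv_pow]
        field_simp
      · rfl
    rw [if_neg (by lia), hj, if_neg (by lia)]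
    simp only [inv_pow]
    field_simp
    ring

theorem tendsto_layerTail (r : ℝ) (j : ℕ) : Tendsto (layerTail p r j) atTop (𝓝 0) := by
  have hpow := tendsto_inv_prime_pow (p := p)
  have hlim : Tendsto (fun k : ℕ => -(lambda0 p / ((p : ℝ) - 1)) *
      (((p : ℝ) ^ j) ^ 2 * (p : ℝ)⁻¹ ^ k / (1 - r * (p : ℝ)⁻¹ ^ k))) atTop
      (𝓝 (-(lambda0 p / ((p : ℝ) - 1)) * (((p : ℝ) ^ j) ^ 2 * 0 / (1 - r * 0)))) :=
    ((hpow.const_mul _).div ((hpow.const_mul r).const_sub 1) (by simp)).const_mul _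
  rw [mul_zero, zero_div, mul_zero] at hlim
  refine hlim.congr' ?_
  filter_upwards [eventually_gt_atTop j] with k hk
  rw [layerTail, if_neg hk.not_ge]

theorem dConverges_B_and_D_B_eq (hx : x ∈ E p m) (hy : y ∈ E p m) (hxy : x ≠ y) :
    DConverges p m (fun z => B p m z y) x ∧ D p m (fun z => B p m z y) x =
      -(min ‖x‖ ‖y‖ / max ‖x‖ ‖y‖ * (lambda0 p / (((p : ℝ) - 1) * (1 - ratio p m y)))) := by
  obtain ⟨j, hj⟩ := exists_d_eq_inv_prime_pow hxy
  obtain ⟨hconv, hsum⟩ := dConverges_and_hasSum_D_comp_d (f := profile p m y)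
    (abs_profile_inv_prime_pow_succ_sub_le hy) hx hy hxy
  refine ⟨hconv, tendsto_nhds_unique hsum.tendsto_sum_nat ?_⟩
  have hterm : ∀ k, (profile p m y ((p : ℝ)⁻¹ ^ (k + 1)) - profile p m y ((p : ℝ)⁻¹ ^ k)) *
      D p m (layer k y) x = min ‖x‖ ‖y‖ / max ‖x‖ ‖y‖ *
        (layerTail p (ratio p m y) j k - layerTail p (ratio p m y) j (k + 1)) := fun k => by
    rw [← profile_sub_mul_layerWeight hy, D_layer hx hy, hj]
    ring
  simp only [hterm, ← Finset.mul_sum, Finset.sum_range_sub']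
  convert! ((tendsto_layerTail (p := p) (ratio p m y) j).const_sub _).const_mul _ using 2
  rw [layerTail, if_pos j.zero_le, pow_zero, pow_zero, mul_one, sub_zero]
  field_simp

theorem min_norm_div_max_norm (hx : x ≠ 0) (hy : y ≠ 0) :
    min ‖x‖ ‖y‖ / max ‖x‖ ‖y‖ = (p : ℝ) ^ (-|x.valuation - y.valuation|) := by
  have hp := one_lt_cast_prime (p := p)
  rw [Padic.norm_eq_zpow_neg_valuation hx, Padic.norm_eq_zpow_neg_valuation hy]
  rcases le_total x.valuation y.valuation with h | h
  · have hle : (p : ℝ) ^ (-y.valuation) ≤ (p : ℝ) ^ (-x.valuation) :=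
      zpow_le_zpow_right₀ hp.le (neg_le_neg h)
    rw [min_eq_right hle, max_eq_left hle, ← zpow_sub₀ cast_prime_pos.ne', abs_of_nonpos (by lia)]
    congr 1
    ring
  · have hle : (p : ℝ) ^ (-x.valuation) ≤ (p : ℝ) ^ (-y.valuation) :=
      zpow_le_zpow_right₀ hp.le (neg_le_neg h)
    rw [min_eq_left hle, max_eq_right hle, ← zpow_sub₀ cast_prime_pos.ne', abs_of_nonneg (by lia)]
    congr 1
    ring

theorem D_B_eq (hx : x ∈ E p m) (hy : y ∈ E p m) (hxy : x ≠ y) :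
    D p m (fun z => B p m z y) x =
      -lambda0 p * (p : ℝ) ^ (-|x.valuation - y.valuation|) *
        (((p : ℝ) + 1) / (((p : ℝ) - 1) * ((p : ℝ) + 1 - U p m y))) := by
  have hp0 := cast_prime_pos (p := p)
  rw [(dConverges_B_and_D_B_eq hx hy hxy).2, ← min_norm_div_max_norm
    (norm_pos_iff.1 (norm_pos_of_mem_E hx)) (norm_pos_iff.1 (norm_pos_of_mem_E hy)), ratio]
  field_simp

theorem norm_kernelD_d_pow_le (hx : x ∈ E p m) (hxy : x ≠ y) (n : ℕ) (z : ℚ_[p]) :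
    ‖kernelD p (fun z => d p z y ^ n) x z‖ ≤ (‖x - y‖ ^ 2)⁻¹ := by
  rcases lt_or_ge ‖z - x‖ ‖x - y‖ with h | h
  · simp [kernelD, d_eq_of_norm_sub_lt h]
  · have hpos : 0 < ‖x - y‖ := norm_pos_iff.2 (sub_ne_zero.2 hxy)
    have hmem : ∀ z, d p z y ^ n ∈ Set.Icc 0 1 := fun z =>
      ⟨pow_nonneg (d_nonneg z y) n, pow_le_one₀ (d_nonneg z y) (d_le_one z y)⟩
    have hsub : ‖d p z y ^ n - d p x y ^ n‖ ≤ 1 - 0 :=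
      abs_sub_le_of_le_of_le (hmem _).1 (hmem _).2 (hmem _).1 (hmem _).2
    calc ‖kernelD p (fun z => d p z y ^ n) x z‖
        = ‖d p z y ^ n - d p x y ^ n‖ / ‖z - x‖ ^ 2 * ‖x‖ := by
          rw [kernelD, norm_mul, norm_div, norm_norm, norm_pow, norm_norm]
      _ ≤ (1 - 0) / ‖x - y‖ ^ 2 * 1 := by
          gcongr
          exact norm_le_one_of_mem_E hx
      _ = (‖x - y‖ ^ 2)⁻¹ := by ring

theorem hasSum_lambda_mul_D_d_pow (hx : x ∈ E p m) (hy : y ∈ E p m) (hxy : x ≠ y) :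
    HasSum (fun n : ℕ => lambda p m (n + 1) y * D p m (fun z => d p z y ^ (n + 1)) x)
      (D p m (fun z => B p m z y) x - lambda0 p * D p m (fun z => Real.logb p (d p z y)) x) := by
  have hint : ∀ n : ℕ, Integrable (fun z => lambda p m (n + 1) y *
      kernelD p (fun z => d p z y ^ (n + 1)) x z) ((addHaar p).restrict (E p m)) := fun n =>
    (dConverges_d_pow hx hy hxy (n + 1)).const_mul _
  have hsummable : Summable fun n : ℕ => ∫ z in E p m, ‖lambda p m (n + 1) y *
      kernelD p (fun z => d p z y ^ (n + 1)) x z‖ ∂addHaar p := by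
    refine ((summable_lambda hy).mul_right
      (∫ _ in E p m, (‖x - y‖ ^ 2)⁻¹ ∂addHaar p)).of_nonneg_of_le
      (fun n => integral_nonneg fun _ => norm_nonneg _) fun n => ?_
    simp_rw [norm_mul, integral_const_mul, Real.norm_of_nonneg (lambda_nonneg n)]
    exact mul_le_mul_of_nonneg_left (integral_mono (dConverges_d_pow hx hy hxy (n + 1)).norm
      (integrable_const _) (norm_kernelD_d_pow_le hx hxy (n + 1))) (lambda_nonneg n)
  have hpointwise : ∀ z, HasSum (fun n : ℕ => lambda p m (n + 1) y *
      kernelD p (fun z => d p z y ^ (n + 1)) x z) (kernelD p (fun z => B p m z y) x z -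
        lambda0 p * kernelD p (fun z => Real.logb p (d p z y)) x z) := fun z => by
    have hseries : ∀ z, HasSum (fun n : ℕ => lambda p m (n + 1) y * d p z y ^ (n + 1))
        (∑' n : ℕ, lambda p m (n + 1) y * d p z y ^ (n + 1)) := fun z =>
      (summable_lambda_mul_pow hy (d_nonneg z y) (d_le_one z y)).hasSum
    convert! ((hseries z).sub (hseries x)).mul_right (‖x‖ / ‖z - x‖ ^ 2) using 1
    · ext n
      rw [kernelD]
      ring
    · rw [kernelD, kernelD, B, B]
      ring
  have hsum := (integrable_and_hasSum_integral hint hsummable (Eventually.of_forall hpointwise)).2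
  rw [integral_sub (dConverges_B_and_D_B_eq hx hy hxy).1
    ((dConverges_logb_d hx hy hxy).const_mul _)] at hsum
  simpa only [integral_const_mul] using! hsum

end LaplacianOfB

section SelfAdjoint

variable {m : ℕ} {y : ℚ_[p]} {f g φ : ℚ_[p] → ℝ}

/-- The integrand of the double integral over `E × E` that computes `⟨f, D g⟩ = ∫_E f D g dμ^×`. -/
noncomputable def pairingKernel (f g : ℚ_[p] → ℝ) (w : ℚ_[p] × ℚ_[p]) : ℝ :=
  f w.1 * (g w.2 - g w.1) / ‖w.2 - w.1‖ ^ 2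

theorem ae_mem_E_prod :
    ∀ᵐ w ∂((addHaar p).restrict (E p m)).prod ((addHaar p).restrict (E p m)),
      w ∈ E p m ×ˢ E p m := by
  rw [Measure.prod_restrict]
  exact ae_restrict_mem (measurableSet_E.prod measurableSet_E)

theorem integrable_pairingKernel {ε : ℝ} (hf : IntegrableOn f (E p m) (addHaar p))
    (hg : IntegrableOn g (E p m) (addHaar p))
    (hfg : IntegrableOn (fun x => f x * g x) (E p m) (addHaar p)) (hε : 0 < ε)
    (h0 : ∀ x ∈ E p m, ∀ z ∈ E p m, ‖z - x‖ < ε → f x * (g z - g x) = 0) :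
    Integrable (pairingKernel f g)
      (((addHaar p).restrict (E p m)).prod ((addHaar p).restrict (E p m))) := by
  refine integrable_div_sq_of_eq_zero ?_ (by fun_prop) hε
    (ae_mem_E_prod.mono fun w hw => h0 w.1 hw.1 w.2 hw.2)
  exact ((hf.mul_prod hg).sub (hfg.comp_fst _)).congr
    (Eventually.of_forall fun w => (mul_sub (f w.1) (g w.2) (g w.1)).symm)

theorem setIntegral_mul_D (hK : Integrable (pairingKernel f g)
      (((addHaar p).restrict (E p m)).prod ((addHaar p).restrict (E p m)))) :
    ∫ x in E p m, f x * D p m g x ∂mulHaar p =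
      ∫ w, pairingKernel f g w ∂((addHaar p).restrict (E p m)).prod
        ((addHaar p).restrict (E p m)) := by
  rw [setIntegral_mulHaar, integral_prod _ hK]
  refine setIntegral_congr_fun measurableSet_E fun x hx => ?_
  have hx0 := (norm_pos_of_mem_E hx).ne'
  simp only [D, kernelD, pairingKernel, integral_mul_const, mul_div_assoc, integral_const_mul]
  field_simp

theorem sub_mul_sub_div_sq_eq (f g : ℚ_[p] → ℝ) (w : ℚ_[p] × ℚ_[p]) :
    (f w.2 - f w.1) * (g w.2 - g w.1) / ‖w.2 - w.1‖ ^ 2 =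
      -(pairingKernel f g w + pairingKernel f g w.swap) := by
  rw [pairingKernel, pairingKernel, Prod.fst_swap, Prod.snd_swap, norm_sub_rev w.1]
  ring

theorem setIntegral_mul_D_eq_neg_half_integral (hK : Integrable (pairingKernel f g)
      (((addHaar p).restrict (E p m)).prod ((addHaar p).restrict (E p m)))) :
    ∫ x in E p m, f x * D p m g x ∂mulHaar p =
      -(1 / 2) * ∫ w, (f w.2 - f w.1) * (g w.2 - g w.1) / ‖w.2 - w.1‖ ^ 2
        ∂((addHaar p).restrict (E p m)).prod ((addHaar p).restrict (E p m)) := by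
  have hadd := integral_add hK hK.swap
  simp only [Function.comp_apply, integral_prod_swap] at hadd
  simp_rw [sub_mul_sub_div_sq_eq]
  rw [integral_neg, hadd, setIntegral_mul_D hK]
  ring

theorem setIntegral_mul_D_comm
    (hfg : Integrable (pairingKernel f g)
      (((addHaar p).restrict (E p m)).prod ((addHaar p).restrict (E p m))))
    (hgf : Integrable (pairingKernel g f)
      (((addHaar p).restrict (E p m)).prod ((addHaar p).restrict (E p m)))) :
    ∫ x in E p m, f x * D p m g x ∂mulHaar p = ∫ x in E p m, g x * D p m f x ∂mulHaar p := by
  rw [setIntegral_mul_D_eq_neg_half_integral hfg, setIntegral_mul_D_eq_neg_half_integral hgf]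
  simp_rw [mul_comm (f _ - f _)]

theorem exists_const_on_ball_of_isLocallyConstant {X β : Type*} [PseudoMetricSpace X] {K : Set X}
    (hK : IsCompact K) {φ : X → β} (hφ : IsLocallyConstant φ) :
    ∃ ε > 0, ∀ x ∈ K, ∀ z, dist z x < ε → φ z = φ x := by
  obtain ⟨ε, hε, hball⟩ := lebesgue_number_lemma_of_metric hK (c := fun b => φ ⁻¹' {b})
    (fun b => hφ {b}) fun x _ => Set.mem_iUnion.2 ⟨φ x, rfl⟩
  refine ⟨ε, hε, fun x hx z hz => ?_⟩
  obtain ⟨b, hb⟩ := hball x hx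
  exact (hb (mem_ball.2 hz)).trans (hb (mem_ball_self hε)).symm

theorem integrableOn_E_of_continuous (hφ : Continuous φ) : IntegrableOn φ (E p m) (addHaar p) :=
  hφ.continuousOn.integrableOn_compact isCompact_E

theorem integrable_pairingKernel_of_isLocallyConstant (hf : IntegrableOn f (E p m) (addHaar p))
    (hφ : IsLocallyConstant φ) :
    Integrable (pairingKernel f φ)
      (((addHaar p).restrict (E p m)).prod ((addHaar p).restrict (E p m))) := by
  obtain ⟨ε, hε, hconst⟩ := exists_const_on_ball_of_isLocallyConstant (isCompact_E (p := p)) hφ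
  refine integrable_pairingKernel hf (integrableOn_E_of_continuous hφ.continuous)
    (hf.mul_continuousOn hφ.continuous.continuousOn isCompact_E) hε fun x hx z _ hzx => ?_
  rw [hconst x hx z (dist_eq_norm z x ▸ hzx), sub_self, mul_zero]

theorem integrable_pairingKernel_of_eq_zero_near {H ψ : ℚ_[p] → ℝ} {ε : ℝ}
    (hH : IntegrableOn H (E p m) (addHaar p)) (hψ : Continuous ψ) (hε : 0 < ε)
    (hψ0 : ∀ x, ‖x - y‖ < ε → ψ x = 0)
    (hconst : ∀ x ∈ E p m, ∀ z, ‖z - x‖ < ‖x - y‖ → ‖z - x‖ < ‖x‖ → H z = H x) :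
    Integrable (pairingKernel ψ H)
      (((addHaar p).restrict (E p m)).prod ((addHaar p).restrict (E p m))) := by
  refine integrable_pairingKernel (integrableOn_E_of_continuous hψ) hH
    (hH.continuousOn_mul hψ.continuousOn isCompact_E)
    (lt_min hε (inv_prime_pow_pos (p := p) m)) fun x hx z _ hzx => ?_
  obtain ⟨hzε, hzm⟩ := lt_min_iff.1 hzx
  rcases lt_or_ge ‖x - y‖ ε with h | h
  · rw [hψ0 x h, zero_mul]
  · rw [hconst x hx z (hzε.trans_le h) (hzm.trans (inv_prime_pow_lt_norm_of_mem_E hx)),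
      sub_self, mul_zero]

theorem D_sub_const (φ : ℚ_[p] → ℝ) (c : ℝ) (x : ℚ_[p]) :
    D p m (fun z => φ z - c) x = D p m φ x := by
  simp only [D, kernelD, sub_sub_sub_cancel_right]

theorem setIntegral_mul_D_of_D_eq_const {H : ℚ_[p] → ℝ} {κ : ℝ} (hy : y ∈ E p m)
    (hH : IntegrableOn H (E p m) (addHaar p))
    (hconst : ∀ x ∈ E p m, ∀ z, ‖z - x‖ < ‖x - y‖ → ‖z - x‖ < ‖x‖ → H z = H x)
    (hD : ∀ x ∈ E p m, x ≠ y → D p m H x = κ) (hφ : IsLocallyConstant φ) :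
    ∫ x in E p m, H x * D p m φ x ∂mulHaar p =
      κ * (∫ x in E p m, φ x ∂mulHaar p - (mulHaar p).real (E p m) * φ y) := by
  have hψ : IsLocallyConstant fun x => φ x - φ y := hφ.comp (· - φ y)
  obtain ⟨ε, hε, hnear⟩ := exists_const_on_ball_of_isLocallyConstant (isCompact_E (p := p)) hφ
  have hψ0 : ∀ x, ‖x - y‖ < ε → φ x - φ y = 0 := fun x hx =>
    sub_eq_zero.2 (hnear y hy x (dist_eq_norm x y ▸ hx))
  have hintegrable : ∀ f : ℚ_[p] → ℝ, Continuous f → IntegrableOn f (E p m) (mulHaar p) :=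
    fun f hf => integrableOn_mulHaar_iff.2 (integrableOn_E_of_continuous hf)
  calc ∫ x in E p m, H x * D p m φ x ∂mulHaar p
      = ∫ x in E p m, H x * D p m (fun z => φ z - φ y) x ∂mulHaar p := by simp only [D_sub_const]
    _ = ∫ x in E p m, (φ x - φ y) * D p m H x ∂mulHaar p :=
        setIntegral_mul_D_comm (integrable_pairingKernel_of_isLocallyConstant hH hψ)
          (integrable_pairingKernel_of_eq_zero_near hH hψ.continuous hε hψ0 hconst)
    _ = ∫ x in E p m, (φ x - φ y) * κ ∂mulHaar p := by
        refine setIntegral_congr_fun measurableSet_E fun x hx => ?_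
        by_cases hxy : x = y
        · simp [hxy]
        · simp [hD x hx hxy]
    _ = κ * (∫ x in E p m, φ x ∂mulHaar p - (mulHaar p).real (E p m) * φ y) := by
        rw [integral_mul_const, integral_sub (hintegrable φ hφ.continuous)
          (hintegrable _ continuous_const), setIntegral_const, smul_eq_mul, mul_comm]

end SelfAdjoint

section Uniqueness

variable {m : ℕ} {φ : ℚ_[p] → ℝ}

theorem eqOn_E_of_setIntegral_mul_D_eq_zero (hφ : IsLocallyConstant φ)
    (henergy : ∫ x in E p m, φ x * D p m φ x ∂mulHaar p = 0) {x z : ℚ_[p]} (hx : x ∈ E p m)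
    (hz : z ∈ E p m) : φ x = φ z := by
  have hK := integrable_pairingKernel_of_isLocallyConstant
    (integrableOn_E_of_continuous (m := m) hφ.continuous) hφ
  have hsq : Integrable (fun w : ℚ_[p] × ℚ_[p] =>
      (φ w.2 - φ w.1) * (φ w.2 - φ w.1) / ‖w.2 - w.1‖ ^ 2)
      (((addHaar p).restrict (E p m)).prod ((addHaar p).restrict (E p m))) :=
    (hK.add hK.swap).neg.congr (Eventually.of_forall fun w => (sub_mul_sub_div_sq_eq φ φ w).symm)
  rw [setIntegral_mul_D_eq_neg_half_integral hK, mul_eq_zero_iff_left (by norm_num),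
    integral_eq_zero_iff_of_nonneg
      (fun w => div_nonneg (mul_self_nonneg _) (sq_nonneg _)) hsq] at henergy
  have hae : (fun w : ℚ_[p] × ℚ_[p] => φ w.1) =ᵐ[((addHaar p).prod (addHaar p)).restrict
      (E p m ×ˢ E p m)] fun w => φ w.2 := by
    rw [← Measure.prod_restrict]
    filter_upwards [henergy] with w hw
    simp only [Pi.zero_apply, div_eq_zero_iff, mul_self_eq_zero, pow_eq_zero_iff two_ne_zero,
      norm_eq_zero, sub_eq_zero] at hw
    exact hw.elim Eq.symm fun h => h ▸ rfl
  have hφc := hφ.continuous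
  exact Measure.eqOn_open_of_ae_eq hae (isClopen_E.isOpen.prod isClopen_E.isOpen)
    (by fun_prop) (by fun_prop) (Set.mk_mem_prod hx hz)

/-- The integral of `H` over the closed ball of radius `p⁻¹ ^ N` around `x`: up to normalisation,
the average that approximates `H` by a locally constant function. -/
noncomputable def ballIntegral (H : ℚ_[p] → ℝ) (N : ℕ) (x : ℚ_[p]) : ℝ :=
  ∫ z in closedBall x ((p : ℝ)⁻¹ ^ N), H z ∂addHaar p

variable {H ξ : ℚ_[p] → ℝ} {N : ℕ}

theorem closedBall_eq_of_norm_sub_le {x z : ℚ_[p]} {r : ℝ} (h : ‖z - x‖ ≤ r) :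
    closedBall z r = closedBall x r :=
  (IsUltrametricDist.closedBall_eq_of_mem (mem_closedBall_iff_norm.2 h)).symm

theorem ballIntegral_eq_of_norm_sub_le {x z : ℚ_[p]} (h : ‖z - x‖ ≤ (p : ℝ)⁻¹ ^ N) :
    ballIntegral H N z = ballIntegral H N x := by
  rw [ballIntegral, ballIntegral, closedBall_eq_of_norm_sub_le h]

theorem isLocallyConstant_of_forall_norm_sub_le {X β : Type*} [SeminormedAddCommGroup X] {φ : X → β}
    {r : ℝ} (hr : 0 < r) (h : ∀ x z, ‖z - x‖ ≤ r → φ z = φ x) : IsLocallyConstant φ :=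
  (IsLocallyConstant.iff_eventually_eq φ).2 fun x => by
    filter_upwards [closedBall_mem_nhds x hr] with z hz
    exact h x z (mem_closedBall_iff_norm.1 hz)

theorem integral_div_sq_congr_of_norm_sub_le {r : ℝ} (h : ∀ x z, ‖z - x‖ ≤ r → φ z = φ x)
    {x x' : ℚ_[p]} (hx : ‖x' - x‖ ≤ r) :
    ∫ z in E p m, (φ z - φ x') / ‖z - x'‖ ^ 2 ∂addHaar p =
      ∫ z in E p m, (φ z - φ x) / ‖z - x‖ ^ 2 ∂addHaar p := by
  congr 1 with z
  rcases le_or_gt ‖z - x‖ r with hz | hz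
  · have hz' : ‖z - x'‖ ≤ r := by
      rw [← sub_sub_sub_cancel_right z x' x]
      exact (norm_sub_le_max _ _).trans (max_le hz hx)
    rw [← h x z hz, ← h x' z hz', sub_self, zero_div, zero_div]
  · rw [h x x' hx, norm_sub_rev z, norm_sub_rev z,
      norm_sub_eq_of_norm_sub_lt (hx.trans_lt (norm_sub_rev z x ▸ hz))]

theorem setIntegral_mul_D_eq_setIntegral (f φ : ℚ_[p] → ℝ) :
    ∫ x in E p m, f x * D p m φ x ∂mulHaar p =
      ∫ x in E p m, f x * ∫ z in E p m, (φ z - φ x) / ‖z - x‖ ^ 2 ∂addHaar p ∂addHaar p := by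
  rw [setIntegral_mulHaar]
  refine setIntegral_congr_fun measurableSet_E fun x hx => ?_
  have hx0 := (norm_pos_of_mem_E hx).ne'
  simp only [D, kernelD, integral_mul_const]
  field_simp

theorem closedBall_inv_prime_pow_subset_E {x : ℚ_[p]} (hx : x ∈ E p m) (hN : m ≤ N) :
    closedBall x ((p : ℝ)⁻¹ ^ N) ⊆ E p m :=
  closedBall_subset_E hx ((inv_prime_pow_le_iff.2 hN).trans_lt (inv_prime_pow_lt_norm_of_mem_E hx))

theorem setIntegral_ballIntegral_mul (hH : IntegrableOn H (E p m) (addHaar p)) (hN : m ≤ N)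
    (hξ : ∀ x z, ‖z - x‖ ≤ (p : ℝ)⁻¹ ^ N → ξ z = ξ x) :
    ∫ x in E p m, ballIntegral H N x * ξ x ∂addHaar p =
      (p : ℝ)⁻¹ ^ N * ∫ x in E p m, H x * ξ x ∂addHaar p := by
  have hξc := (isLocallyConstant_of_forall_norm_sub_le (inv_prime_pow_pos N) hξ).continuous
  have hHξ : IntegrableOn (fun x => H x * ξ x) (E p m) (addHaar p) :=
    hH.mul_continuousOn hξc.continuousOn isCompact_E
  have hclosed : IsClosed {w : ℚ_[p] × ℚ_[p] | ‖w.2 - w.1‖ ≤ (p : ℝ)⁻¹ ^ N} :=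
    isClosed_le (by fun_prop) continuous_const
  have hswap := integral_integral_swap (μ := (addHaar p).restrict (E p m))
    (f := fun x z => (closedBall x ((p : ℝ)⁻¹ ^ N)).indicator (fun z => H z * ξ z) z)
    (((hHξ.comp_snd ((addHaar p).restrict (E p m))).indicator hclosed.measurableSet).congr
      (Eventually.of_forall fun w => by
        simp only [Function.uncurry, Set.indicator, mem_closedBall_iff_norm,
          Set.mem_ofPred_eq]))
  have hball : ∀ x ∈ E p m, ∀ f : ℚ_[p] → ℝ,
      ∫ z in E p m, (closedBall x ((p : ℝ)⁻¹ ^ N)).indicator f z ∂addHaar p =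
        ∫ z in closedBall x ((p : ℝ)⁻¹ ^ N), f z ∂addHaar p := fun x hx f => by
    rw [setIntegral_indicator measurableSet_closedBall,
      Set.inter_eq_self_of_subset_right (closedBall_inv_prime_pow_subset_E hx hN)]
  calc ∫ x in E p m, ballIntegral H N x * ξ x ∂addHaar p
      = ∫ x in E p m, ∫ z in E p m, (closedBall x ((p : ℝ)⁻¹ ^ N)).indicator
          (fun z => H z * ξ z) z ∂addHaar p ∂addHaar p := by
        refine setIntegral_congr_fun measurableSet_E fun x hx => ?_
        simp only [hball x hx]
        rw [ballIntegral, ← integral_mul_const]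
        refine setIntegral_congr_fun measurableSet_closedBall fun z hz => ?_
        simp only [hξ x z (mem_closedBall_iff_norm.1 hz)]
    _ = ∫ z in E p m, ∫ x in E p m, (closedBall z ((p : ℝ)⁻¹ ^ N)).indicator
          (fun _ => H z * ξ z) x ∂addHaar p ∂addHaar p := by
        rw [hswap]
        simp only [Set.indicator, mem_closedBall, dist_comm]
    _ = (p : ℝ)⁻¹ ^ N * ∫ x in E p m, H x * ξ x ∂addHaar p := by
        rw [← integral_const_mul]
        refine setIntegral_congr_fun measurableSet_E fun z hz => ?_
        simp only [hball z hz, setIntegral_const, addHaar_real_closedBall, smul_eq_mul]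

theorem ballIntegral_eq_of_setIntegral_mul_D_eq_zero (hH : IntegrableOn H (E p m) (addHaar p))
    (hweak : ∀ φ : ℚ_[p] → ℝ, IsLocallyConstant φ →
      ∫ x in E p m, H x * D p m φ x ∂mulHaar p = 0) (hN : m ≤ N) {x z : ℚ_[p]} (hx : x ∈ E p m)
    (hz : z ∈ E p m) : ballIntegral H N x = ballIntegral H N z := by
  have hconst : ∀ x z, ‖z - x‖ ≤ (p : ℝ)⁻¹ ^ N → ballIntegral H N z = ballIntegral H N x :=
    fun _ _ => ballIntegral_eq_of_norm_sub_le
  have hlc := isLocallyConstant_of_forall_norm_sub_le (inv_prime_pow_pos N) hconst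
  refine eqOn_E_of_setIntegral_mul_D_eq_zero hlc ?_ hx hz
  rw [setIntegral_mul_D_eq_setIntegral, setIntegral_ballIntegral_mul hH hN fun _ _ =>
    integral_div_sq_congr_of_norm_sub_le hconst, ← setIntegral_mul_D_eq_setIntegral,
    hweak _ hlc, mul_zero]

theorem tendsto_ballIntegral_div {x : ℚ_[p]} (hH : IntegrableOn H (E p m) (addHaar p))
    (hx : x ∈ E p m) (hHx : ContinuousAt H x) :
    Tendsto (fun N => ballIntegral H N x / (p : ℝ)⁻¹ ^ N) atTop (𝓝 (H x)) := by
  have hlittle := hHx.integral_sub_linear_isLittleO_ae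
    ⟨E p m, isClopen_E.isOpen.mem_nhds hx, hH.aestronglyMeasurable⟩
    ((tendsto_closedBall_smallSets x).comp tendsto_inv_prime_pow)
    (fun N => (p : ℝ)⁻¹ ^ N) (Eventually.of_forall fun N => addHaar_real_closedBall x N)
  refine (((hlittle.tendsto_div_nhds_zero).add_const (H x)).congr fun N => ?_).trans_eq ?_
  · have := (inv_prime_pow_pos (p := p) N).ne'
    simp only [Function.comp_apply, ballIntegral, smul_eq_mul]
    rw [sub_div, mul_div_cancel_left₀ _ this, sub_add_cancel]
  · rw [zero_add]

theorem eq_of_setIntegral_mul_D_eq_zero (hH : IntegrableOn H (E p m) (addHaar p))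
    (hweak : ∀ φ : ℚ_[p] → ℝ, IsLocallyConstant φ →
      ∫ x in E p m, H x * D p m φ x ∂mulHaar p = 0) {x z : ℚ_[p]} (hx : x ∈ E p m)
    (hHx : ContinuousAt H x) (hz : z ∈ E p m) (hHz : ContinuousAt H z) : H x = H z := by
  refine tendsto_nhds_unique (tendsto_ballIntegral_div hH hx hHx)
    ((tendsto_ballIntegral_div hH hz hHz).congr' ?_)
  filter_upwards [eventually_ge_atTop m] with N hN
  rw [ballIntegral_eq_of_setIntegral_mul_D_eq_zero hH hweak hN hx hz]

end Uniqueness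

section GreenUniqueness

variable {m : ℕ} {φ : ℚ_[p] → ℝ}

theorem setIntegral_sub_mul_D {f g : ℚ_[p] → ℝ} (hf : IntegrableOn f (E p m) (addHaar p))
    (hg : IntegrableOn g (E p m) (addHaar p)) (hφ : IsLocallyConstant φ) :
    ∫ x in E p m, (f x - g x) * D p m φ x ∂mulHaar p =
      ∫ x in E p m, f x * D p m φ x ∂mulHaar p - ∫ x in E p m, g x * D p m φ x ∂mulHaar p := by
  have hfK := integrable_pairingKernel_of_isLocallyConstant hf hφ
  have hgK := integrable_pairingKernel_of_isLocallyConstant hg hφ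
  have hsub : IntegrableOn (fun x => f x - g x) (E p m) (addHaar p) := hf.sub hg
  rw [setIntegral_mul_D hfK, setIntegral_mul_D hgK, ← integral_sub hfK hgK,
    setIntegral_mul_D (integrable_pairingKernel_of_isLocallyConstant hsub hφ)]
  congr 1 with w
  simp only [pairingKernel]
  ring

theorem infinite_E (hm : 1 ≤ m) : (E p m).Infinite :=
  infinite_of_mem_nhds 1 (isClopen_E.isOpen.mem_nhds ⟨0, hm, 1, by simp⟩)

theorem exists_forall_eq_of_symm_of_eq_off_diagonal {α β : Type*} {s : Set α} (hs : s.Infinite)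
    {Δ : α → α → β} (hsymm : ∀ x ∈ s, ∀ y ∈ s, Δ x y = Δ y x)
    (hconst : ∀ y ∈ s, ∀ x ∈ s, ∀ z ∈ s, x ≠ y → z ≠ y → Δ x y = Δ z y) :
    ∃ k, ∀ x ∈ s, ∀ y ∈ s, x ≠ y → Δ x y = k := by
  classical
  obtain ⟨a, ha, b, hb, hab⟩ := hs.nontrivial
  refine ⟨Δ a b, fun x hx y hy hxy => ?_⟩
  obtain ⟨z, hz, hzby⟩ := hs.exists_notMem_finset {b, y}
  obtain ⟨hzb, hzy⟩ : z ≠ b ∧ z ≠ y := by simpa using hzby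
  calc Δ x y = Δ z y := hconst y hy x hx z hz hxy hzy
    _ = Δ y z := hsymm z hz y hy
    _ = Δ b z := hconst z hz y hy b hb hzy.symm hzb.symm
    _ = Δ z b := hsymm b hb z hz
    _ = Δ a b := hconst b hb z hz a ha hzb hab

theorem IsGreen.continuousAt {G : ℚ_[p] → ℚ_[p] → ℝ} (hG : IsGreen p m G) {x y : ℚ_[p]}
    (hx : x ∈ E p m) (hy : y ∈ E p m) (hxy : x ≠ y) : ContinuousAt (fun z => G z y) x := by
  have hon : ContinuousOn (fun z => G z y) {z | z ∈ E p m ∧ z ≠ y} :=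
    hG.continuousOn.comp (f := fun z => (z, y)) (by fun_prop) fun z hz => ⟨hz.1, hy, hz.2⟩
  exact hon.continuousAt ((isClopen_E.isOpen.inter isOpen_ne).mem_nhds ⟨hx, hxy⟩)

theorem IsGreen.exists_eq_add_const {G G' : ℚ_[p] → ℚ_[p] → ℝ} (hm : 1 ≤ m) (hG : IsGreen p m G)
    (hG' : IsGreen p m G') :
    ∃ k : ℝ, ∀ x ∈ E p m, ∀ y ∈ E p m, x ≠ y → G x y = G' x y + k := by
  have hconst : ∀ y ∈ E p m, ∀ x ∈ E p m, ∀ z ∈ E p m, x ≠ y → z ≠ y →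
      G x y - G' x y = G z y - G' z y := fun y hy x hx z hz hxy hzy => by
    have hGy := integrableOn_mulHaar_iff.1 (hG.integrableOn y hy)
    have hGy' := integrableOn_mulHaar_iff.1 (hG'.integrableOn y hy)
    have hcont : ∀ a ∈ E p m, a ≠ y → ContinuousAt (fun x => G x y - G' x y) a :=
      fun a ha hay => (hG.continuousAt ha hy hay).sub (hG'.continuousAt ha hy hay)
    refine eq_of_setIntegral_mul_D_eq_zero (H := fun x => G x y - G' x y) (hGy.sub hGy')
      (fun φ hφ => ?_) hx (hcont x hx hxy) hz (hcont z hz hzy)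
    rw [setIntegral_sub_mul_D hGy hGy' hφ, hG.green y hy φ hφ, hG'.green y hy φ hφ, sub_self]
  obtain ⟨k, hk⟩ := exists_forall_eq_of_symm_of_eq_off_diagonal (infinite_E hm)
    (fun x hx y hy => by rw [hG.symm x hx y hy, hG'.symm x hx y hy]) hconst
  exact ⟨k, fun x hx y hy hxy => sub_eq_iff_eq_add'.1 (hk x hx y hy hxy)⟩

end GreenUniqueness

section GraphLaplacian

open Matrix

theorem allOnes_mul_allOnes {ι : Type*} [Fintype ι] :
    (Matrix.of fun _ _ => 1 : Matrix ι ι ℝ) * Matrix.of (fun _ _ => 1) =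
      (Fintype.card ι : ℝ) • Matrix.of fun _ _ => 1 := by
  ext i j
  simp [mul_apply]

variable {ι : Type*} [Fintype ι] [DecidableEq ι]

theorem isUnit_det_allOnes_sub {L : Matrix ι ι ℝ}
    (hJL : Matrix.of (fun _ _ => (1 : ℝ)) * L = 0) (hker : ∀ f, L *ᵥ f = 0 → ∀ i j, f i = f j) :
    IsUnit (Matrix.of (fun _ _ => (1 : ℝ)) - L).det := by
  set J : Matrix ι ι ℝ := Matrix.of fun _ _ => 1 with hJ
  refine (isUnit_iff_isUnit_det _).1 (mulVec_injective_iff_isUnit.1 <|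
    (injective_iff_map_eq_zero (J - L).mulVecLin).2 fun f hf => funext fun i => ?_)
  have : Nonempty ι := ⟨i⟩
  have hcard : (Fintype.card ι : ℝ) ≠ 0 := Nat.cast_ne_zero.2 Fintype.card_ne_zero
  rw [mulVecLin_apply] at hf
  have hJf : J *ᵥ f = 0 := by
    have hJM : J *ᵥ ((J - L) *ᵥ f) = 0 := by rw [hf, mulVec_zero]
    rw [mulVec_mulVec, mul_sub, hJL, sub_zero, allOnes_mul_allOnes, smul_mulVec] at hJM
    exact (smul_eq_zero.1 hJM).resolve_left hcard
  have hLf : L *ᵥ f = 0 := by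
    rw [sub_mulVec, hJf, zero_sub, neg_eq_zero] at hf
    exact hf
  have hsum : ∑ j, f j = 0 := by simpa [hJ, mulVec, dotProduct] using congrFun hJf i
  rw [Finset.sum_congr rfl fun j _ => hker f hLf j i] at hsum
  simpa [hcard] using hsum

theorem exists_isSymm_mul_eq_one_sub {L : Matrix ι ι ℝ} (hL : L.IsSymm) (hL1 : L *ᵥ 1 = 0)
    (hker : ∀ f, L *ᵥ f = 0 → ∀ i j, f i = f j) :
    ∃ N : Matrix ι ι ℝ, N.IsSymm ∧
      L * N = 1 - (Fintype.card ι : ℝ)⁻¹ • Matrix.of fun _ _ => (1 : ℝ) := by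
  set J : Matrix ι ι ℝ := Matrix.of fun _ _ => 1 with hJ
  have hJL : J * L = 0 := by
    ext i j
    simpa [hJ, mul_apply, mulVec, dotProduct, hL.apply] using congrFun hL1 j
  have hdet : IsUnit (J - L).det := isUnit_det_allOnes_sub hJL hker
  have hJinv : J * (J - L)⁻¹ = (Fintype.card ι : ℝ)⁻¹ • J := by
    rcases isEmpty_or_nonempty ι with hι | hι
    · exact Subsingleton.elim _ _
    · have hcard : (Fintype.card ι : ℝ) ≠ 0 := Nat.cast_ne_zero.2 Fintype.card_ne_zero
      rw [eq_inv_smul_iff₀ hcard, ← smul_mul, ← allOnes_mul_allOnes, ← sub_zero (J * J), ← hJL,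
        ← mul_sub, mul_nonsing_inv_cancel_right _ _ hdet]
  refine ⟨-(J - L)⁻¹, ?_, ?_⟩
  · have hJsymm : J.IsSymm := rfl
    exact ((hJsymm.sub hL).inv).neg
  · calc L * -(J - L)⁻¹ = (J - L) * (J - L)⁻¹ - J * (J - L)⁻¹ := by noncomm_ring
      _ = 1 - (Fintype.card ι : ℝ)⁻¹ • J := by rw [mul_nonsing_inv _ hdet, hJinv]

/-- The Laplacian `f ↦ ∑ j, w i j * (f j - f i)` of the complete graph on `ι` with edge weights
`w`. -/
def weightedLaplacian (w : ι → ι → ℝ) : Matrix ι ι ℝ :=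
  Matrix.of w - diagonal fun i => ∑ j, w i j

theorem weightedLaplacian_mulVec (w : ι → ι → ℝ) (f : ι → ℝ) (i : ι) :
    (weightedLaplacian w *ᵥ f) i = ∑ j, w i j * (f j - f i) := by
  rw [weightedLaplacian, sub_mulVec, Pi.sub_apply, mulVec_diagonal, Finset.sum_mul]
  simp [mulVec, dotProduct, mul_sub]

theorem eq_of_weightedLaplacian_mulVec_eq_zero {w : ι → ι → ℝ} (hw : ∀ i j, 0 < w i j)
    {f : ι → ℝ} (hf : weightedLaplacian w *ᵥ f = 0) (i j : ι) : f i = f j := by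
  have : Nonempty ι := ⟨i⟩
  obtain ⟨k, hk⟩ := Finite.exists_min f
  have hzero := congrFun hf k
  rw [weightedLaplacian_mulVec, Pi.zero_apply, Finset.sum_eq_zero_iff_of_nonneg
    fun j _ => mul_nonneg (hw k j).le (sub_nonneg.2 (hk j))] at hzero
  have hmin : ∀ j, f j = f k := fun j =>
    sub_eq_zero.1 ((mul_eq_zero.1 (hzero j (Finset.mem_univ j))).resolve_left (hw k j).ne')
  rw [hmin i, hmin j]

theorem isSymm_weightedLaplacian {w : ι → ι → ℝ} (hw : ∀ i j, w i j = w j i) :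
    (weightedLaplacian w).IsSymm :=
  IsSymm.sub (IsSymm.ext fun i j => hw j i) (isSymm_diagonal _)

end GraphLaplacian

section Correction

theorem exists_symm_sum_mul_sub_eq {ι : Type*} [Fintype ι] {w : ι → ι → ℝ} (hw : ∀ i j, 0 < w i j)
    (hsymm : ∀ i j, w i j = w j i) :
    ∃ C : ι → ι → ℝ, (∀ i j, C i j = C j i) ∧ ∀ i k,
      ∑ j, w i j * (C j k - C i k) = w i k / ∑ j, w k j - (Fintype.card ι : ℝ)⁻¹ := by
  classical
  obtain ⟨N, hN, hLN⟩ := exists_isSymm_mul_eq_one_sub (isSymm_weightedLaplacian hsymm)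
    (by ext i; simp [weightedLaplacian_mulVec])
    fun f hf => eq_of_weightedLaplacian_mulVec_eq_zero hw hf
  have hNsum (i k : ι) :
      ∑ j, w i j * (N j k - N i k) = (if i = k then 1 else 0) - (Fintype.card ι : ℝ)⁻¹ := by
    rw [← weightedLaplacian_mulVec w fun j => N j k]
    exact (congrFun (congrFun hLN i) k).trans (by simp [Matrix.one_apply])
  have hdeg (k : ι) : ∑ j, w k j ≠ 0 :=
    (Finset.sum_pos (fun j _ => hw k j) ⟨k, Finset.mem_univ k⟩).ne'
  refine ⟨fun i j => N i j + if i = j then (∑ l, w j l)⁻¹ else 0, fun i j => ?_, fun i k => ?_⟩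
  · rcases eq_or_ne i j with rfl | hij
    · rfl
    · simp only [if_neg hij, if_neg hij.symm, hN.apply i j]
  · calc ∑ j, w i j * ((N j k + if j = k then (∑ l, w k l)⁻¹ else 0) -
          (N i k + if i = k then (∑ l, w k l)⁻¹ else 0))
        = ∑ j, w i j * (N j k - N i k) + w i k * (∑ l, w k l)⁻¹ -
          (∑ j, w i j) * if i = k then (∑ l, w k l)⁻¹ else 0 := by
          generalize (if i = k then (∑ l, w k l)⁻¹ else 0) = c
          simp only [mul_sub, mul_add, Finset.sum_sub_distrib, Finset.sum_add_distrib, mul_ite,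
            mul_zero, Finset.sum_ite_eq', Finset.mem_univ, if_true, ← Finset.sum_mul]
          ring
      _ = w i k / ∑ j, w k j - (Fintype.card ι : ℝ)⁻¹ := by
          rw [hNsum]
          rcases eq_or_ne i k with rfl | hik
          · rw [if_pos rfl, if_pos rfl, mul_inv_cancel₀ (hdeg i)]
            ring
          · rw [if_neg hik, if_neg hik]
            ring

theorem exists_symm_finset_sum_mul_sub_eq {α : Type*} {S : Finset α} {w : α → α → ℝ}
    (hw : ∀ a ∈ S, ∀ b ∈ S, 0 < w a b) (hsymm : ∀ a b, w a b = w b a) :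
    ∃ C : α → α → ℝ, (∀ a b, C a b = C b a) ∧ ∀ a ∈ S, ∀ b ∈ S,
      ∑ c ∈ S, w a c * (C c b - C a b) = w a b / ∑ c ∈ S, w b c - (S.card : ℝ)⁻¹ := by
  classical
  obtain ⟨C, hC, hsum⟩ := exists_symm_sum_mul_sub_eq (w := fun i j : S => w i j)
    (fun i j => hw i i.2 j j.2) fun i j => hsymm i j
  refine ⟨fun a b => if h : a ∈ S ∧ b ∈ S then C ⟨a, h.1⟩ ⟨b, h.2⟩ else 0, fun a b => ?_,
    fun a ha b hb => ?_⟩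
  · by_cases h : a ∈ S ∧ b ∈ S
    · simp only [dif_pos h, dif_pos h.symm, hC ⟨a, h.1⟩]
    · simp only [dif_neg h, dif_neg fun h' : b ∈ S ∧ a ∈ S => h h'.symm]
  · rw [← Finset.sum_coe_sort S, ← Finset.sum_coe_sort S]
    simpa [ha, hb] using hsum ⟨a, ha⟩ ⟨b, hb⟩

end Correction

section Existence

variable {m : ℕ} {x y : ℚ_[p]}

theorem integrableOn_E_norm (F : ℝ → ℝ) :
    IntegrableOn (fun z => F ‖z‖) (E p m) (addHaar p) :=
  ContinuousOn.integrableOn_compact isCompact_E fun _ hx =>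
    (continuousAt_const.congr ((eventually_norm_eq continuousAt_id
      (norm_pos_of_mem_E hx).ne').mono fun _ hz => (congrArg F hz).symm)).continuousWithinAt

theorem dConverges_norm (F : ℝ → ℝ) (hx : x ∈ E p m) : DConverges p m (fun z => F ‖z‖) x :=
  dConverges_of_const_near (integrableOn_E_norm F) (norm_pos_of_mem_E hx) fun z hz => by
    rw [norm_eq_of_norm_sub_lt hz]

/-- The integral of `‖x‖ / ‖z - x‖ ^ 2` over the sphere `‖z‖ = b`, where `‖x‖ = a ≠ b`. On functions
of the norm, `D` is the Laplacian of the complete graph on `normValues p m` with these edge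
weights; the value at `a = b` is the one that makes the degrees come out as `(p + 1 - U) / p`. -/
noncomputable def shellWeight (p : ℕ) (a b : ℝ) : ℝ := (1 - (p : ℝ)⁻¹) * (a * b / max a b ^ 2)

theorem shellWeight_comm (p : ℕ) (a b : ℝ) : shellWeight p a b = shellWeight p b a := by
  rw [shellWeight, shellWeight, max_comm, mul_comm a]

theorem pos_of_mem_normValues {a : ℝ} (ha : a ∈ normValues p m) : 0 < a := by
  obtain ⟨i, -, rfl⟩ := Finset.mem_image.1 ha
  exact inv_prime_pow_pos i

theorem shellWeight_pos {a b : ℝ} (ha : 0 < a) (hb : 0 < b) : 0 < shellWeight p a b := by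
  have hp : 0 < 1 - (p : ℝ)⁻¹ := sub_pos.2 inv_prime_lt_one
  have : 0 < max a b := lt_max_of_lt_left ha
  unfold shellWeight
  positivity

theorem card_normValues : (normValues p m).card = m := by
  rw [normValues, Finset.card_image_of_injective _ inv_prime_pow_injective, Finset.card_range]

theorem D_norm (F : ℝ → ℝ) (x : ℚ_[p]) :
    D p m (fun z => F ‖z‖) x =
      ∑ a ∈ normValues p m, shellWeight p ‖x‖ a * (F a - F ‖x‖) := by
  have hkernel : kernelD p (fun z => F ‖z‖) x = fun z =>
      (fun a => (F a - F ‖x‖) / max ‖x‖ a ^ 2 * ‖x‖) ‖z‖ := by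
    funext z
    rcases eq_or_ne ‖z‖ ‖x‖ with h | h
    · simp [kernelD, h]
    · simp only [kernelD, norm_sub_eq_max_of_norm_ne h, max_comm]
  rw [D, hkernel, setIntegral_E_norm fun a => (F a - F ‖x‖) / max ‖x‖ a ^ 2 * ‖x‖, Finset.mul_sum]
  refine Finset.sum_congr rfl fun a _ => ?_
  rw [shellWeight]
  ring

theorem sum_shellWeight (hy : y ∈ E p m) :
    ∑ a ∈ normValues p m, shellWeight p ‖y‖ a = ((p : ℝ) + 1 - U p m y) / p := by
  obtain ⟨s, -, hs⟩ := exists_norm_eq_of_mem_E hy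
  have hp := cast_prime_pos (p := p)
  set β := closedBall y ((p : ℝ)⁻¹ ^ (s + 1)) with hβ
  have hlt : (p : ℝ)⁻¹ ^ (s + 1) < ‖y‖ := hs ▸ inv_prime_pow_lt_iff.2 s.lt_succ_self
  have hsub : β ⊆ E p m := closedBall_subset_E hy hlt
  have hmem : Set.EqOn (fun z => ‖y‖ / max ‖y‖ ‖z‖ ^ 2) (fun _ => ‖y‖⁻¹) β := fun z hz => by
    have hz' : ‖z‖ = ‖y‖ := norm_eq_of_norm_sub_lt
      ((dist_eq_norm z y ▸ mem_closedBall.1 hz).trans_lt hlt)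
    simp [hz', sq, div_self_mul_self']
  have hnotMem : Set.EqOn (fun z => ‖y‖ / max ‖y‖ ‖z‖ ^ 2) (fun z => ‖y‖ * (‖z - y‖ ^ 2)⁻¹)
      (E p m \ β) := fun z hz => by
    have hle : ‖y‖ ≤ ‖z - y‖ := not_lt.1 fun h => hz.2 <| by
      simpa [hβ, dist_eq_norm] using norm_le_inv_prime_pow_succ (hs ▸ h)
    have hmax : max ‖y‖ ‖z‖ = ‖z - y‖ := by
      refine le_antisymm (max_le hle ?_) (max_comm ‖y‖ ‖z‖ ▸ norm_sub_le_max z y)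
      simpa [hle] using IsUltrametricDist.norm_add_le_max (z - y) y
    simp only [hmax, div_eq_mul_inv]
  calc ∑ a ∈ normValues p m, shellWeight p ‖y‖ a
      = ∫ z in E p m, ‖y‖ / max ‖y‖ ‖z‖ ^ 2 ∂addHaar p := by
        rw [setIntegral_E_norm fun a => ‖y‖ / max ‖y‖ a ^ 2, Finset.mul_sum]
        refine Finset.sum_congr rfl fun a _ => ?_
        rw [shellWeight]
        ring
    _ = ∫ _ in β, ‖y‖⁻¹ ∂addHaar p + ‖y‖ * ∫ z in E p m \ β, (‖z - y‖ ^ 2)⁻¹ ∂addHaar p := by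
        rw [← setIntegral_congr_fun isClosed_closedBall.measurableSet hmem, ← integral_const_mul,
          ← setIntegral_congr_fun (measurableSet_E.diff isClosed_closedBall.measurableSet) hnotMem,
          ← integral_inter_add_sdiff isClosed_closedBall.measurableSet
            (integrableOn_E_norm fun a => ‖y‖ / max ‖y‖ a ^ 2), Set.inter_eq_right.2 hsub]
    _ = ((p : ℝ) + 1 - U p m y) / p := by
        rw [setIntegral_const, hβ, addHaar_real_closedBall,
          setIntegral_E_diff_closedBall_inv_sq_norm_sub hy hlt, U, hs, zpow_sub₀ hp.ne', zpow_one,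
          zpow_natCast]
        simp only [inv_pow, smul_eq_mul]
        field_simp
        ring

theorem D_B_eq_neg_shellWeight_div (hx : x ∈ E p m) (hy : y ∈ E p m) (hxy : x ≠ y) :
    D p m (fun z => B p m z y) x = -((1 - (p : ℝ)⁻¹)⁻¹ *
      (shellWeight p ‖x‖ ‖y‖ / ∑ a ∈ normValues p m, shellWeight p ‖y‖ a)) := by
  have hp := cast_prime_pos (p := p)
  have hp1 : (p : ℝ) - 1 ≠ 0 := (sub_pos.2 one_lt_cast_prime).ne'
  have hr : 1 - ratio p m y ≠ 0 := (sub_pos.2 (ratio_lt_one hy)).ne'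
  have hsum : ((p : ℝ) + 1 - U p m y) / p = (p + 1) / p * (1 - ratio p m y) := by
    rw [ratio]
    field_simp
  have hmax : 0 < max ‖x‖ ‖y‖ := lt_max_of_lt_left (norm_pos_of_mem_E hx)
  have hmin : min ‖x‖ ‖y‖ / max ‖x‖ ‖y‖ = ‖x‖ * ‖y‖ / max ‖x‖ ‖y‖ ^ 2 := by
    rw [← min_mul_max ‖x‖ ‖y‖]
    field_simp
  rw [(dConverges_B_and_D_B_eq hx hy hxy).2, sum_shellWeight hy, hsum, hmin, shellWeight, lambda0]
  field_simp

theorem exists_symm_D_norm_eq (p : ℕ) [Fact p.Prime] (m : ℕ) :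
    ∃ C : ℝ → ℝ → ℝ, (∀ a b, C a b = C b a) ∧ ∀ x ∈ E p m, ∀ y ∈ E p m,
      D p m (fun z => C ‖z‖ ‖y‖) x = (1 - (p : ℝ)⁻¹)⁻¹ *
        (shellWeight p ‖x‖ ‖y‖ / ∑ a ∈ normValues p m, shellWeight p ‖y‖ a - (m : ℝ)⁻¹) := by
  obtain ⟨C, hC, hsum⟩ := exists_symm_finset_sum_mul_sub_eq (S := normValues p m)
    (w := shellWeight p)
    (fun a ha b hb => shellWeight_pos (pos_of_mem_normValues ha) (pos_of_mem_normValues hb))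
    (shellWeight_comm p)
  rw [card_normValues] at hsum
  refine ⟨fun a b => (1 - (p : ℝ)⁻¹)⁻¹ * C a b, fun a b => by simp only [hC a b],
    fun x hx y hy => ?_⟩
  rw [D_norm fun a => (1 - (p : ℝ)⁻¹)⁻¹ * C a ‖y‖,
    ← hsum _ (mem_E_iff.1 hx) _ (mem_E_iff.1 hy), Finset.mul_sum]
  exact Finset.sum_congr rfl fun a _ => by ring

theorem kernelD_add (f g : ℚ_[p] → ℝ) (x : ℚ_[p]) :
    kernelD p (fun z => f z + g z) x = fun z => kernelD p f x z + kernelD p g x z := by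
  funext z
  simp only [kernelD]
  ring

theorem D_add {f g : ℚ_[p] → ℝ} (hf : DConverges p m f x) (hg : DConverges p m g x) :
    D p m (fun z => f z + g z) x = D p m f x + D p m g x := by
  rw [D, kernelD_add]
  exact integral_add hf hg

theorem DConverges.integrableOn {f : ℚ_[p] → ℝ} (hx : x ≠ 0) (hf : DConverges p m f x) :
    IntegrableOn f (E p m) (addHaar p) := by
  have hkernel : f = fun z => kernelD p f x z * (‖z - x‖ ^ 2 / ‖x‖) + f x := by
    funext z
    rcases eq_or_ne z x with rfl | hz
    · simp [kernelD]
    · have hx0 : ‖x‖ ≠ 0 := norm_ne_zero_iff.2 hx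
      have hzx : ‖z - x‖ ≠ 0 := norm_ne_zero_iff.2 (sub_ne_zero.2 hz)
      rw [kernelD]
      field_simp
      ring
  rw [hkernel]
  exact (IntegrableOn.mul_continuousOn hf (by fun_prop) isCompact_E).add (integrable_const _)

theorem integrableOn_B (hy : y ∈ E p m) :
    IntegrableOn (fun z => B p m z y) (E p m) (addHaar p) := by
  have hy0 : y ≠ 0 := norm_pos_iff.1 (norm_pos_of_mem_E hy)
  exact (dConverges_B_and_D_B_eq (mem_E_of_norm_eq (norm_neg y) hy) hy
    (neg_ne_self.2 hy0)).1.integrableOn (neg_ne_zero.2 hy0)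

theorem B_congr {x' y' : ℚ_[p]} (hx : ‖x'‖ = ‖x‖) (hy : ‖y'‖ = ‖y‖) (h : ‖x' - y'‖ = ‖x - y‖) :
    B p m x' y' = B p m x y := by
  simp only [B, A, lambda, U, d, hx, hy, h]

theorem B_eq_zero_of_norm_ne (h : ‖x‖ ≠ ‖y‖) : B p m x y = 0 := by
  simp [B, A, d_of_norm_ne h]

theorem B_comm (x y : ℚ_[p]) : B p m x y = B p m y x := by
  by_cases h : ‖x‖ = ‖y‖
  · exact B_congr h h.symm (norm_sub_rev x y)
  · rw [B_eq_zero_of_norm_ne h, B_eq_zero_of_norm_ne (Ne.symm h)]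

theorem continuousOn_of_norm_congr {G : ℚ_[p] → ℚ_[p] → ℝ}
    (hG : ∀ x y x' y' : ℚ_[p], ‖x'‖ = ‖x‖ → ‖y'‖ = ‖y‖ → ‖x' - y'‖ = ‖x - y‖ → G x' y' = G x y) :
    ContinuousOn (fun w : ℚ_[p] × ℚ_[p] => G w.1 w.2)
      {w | w.1 ∈ E p m ∧ w.2 ∈ E p m ∧ w.1 ≠ w.2} := by
  rintro ⟨x, y⟩ ⟨hx, hy, hxy⟩
  refine ((continuousAt_const (y := G x y)).congr ?_).continuousWithinAt
  filter_upwards [eventually_norm_eq continuousAt_fst (norm_pos_of_mem_E hx).ne',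
    eventually_norm_eq continuousAt_snd (norm_pos_of_mem_E hy).ne',
    eventually_norm_eq (continuousAt_fst.sub continuousAt_snd)
      (norm_ne_zero_iff.2 (sub_ne_zero.2 hxy))] with w hw₁ hw₂ hw
  exact (hG _ _ _ _ hw₁ hw₂ hw).symm

theorem exists_isGreen (p : ℕ) [Fact p.Prime] {m : ℕ} (hm : 1 ≤ m) :
    ∃ C : ℝ → ℝ → ℝ, IsGreen p m fun x y => B p m x y + C ‖x‖ ‖y‖ := by
  obtain ⟨C, hC, hDC⟩ := exists_symm_D_norm_eq p m
  have hV : (mulHaar p).real (E p m) ≠ 0 := by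
    rw [mulHaar_real_E]
    exact (mul_pos (by exact_mod_cast hm) (sub_pos.2 inv_prime_lt_one)).ne'
  have hint : ∀ y ∈ E p m,
      IntegrableOn (fun x => B p m x y + C ‖x‖ ‖y‖) (E p m) (addHaar p) := fun y hy =>
    (integrableOn_B hy).add (integrableOn_E_norm fun a => C a ‖y‖)
  have hD : ∀ y ∈ E p m, ∀ x ∈ E p m, x ≠ y →
      D p m (fun x => B p m x y + C ‖x‖ ‖y‖) x = -((mulHaar p).real (E p m))⁻¹ := by
    intro y hy x hx hxy
    rw [D_add (dConverges_B_and_D_B_eq hx hy hxy).1 (dConverges_norm (fun a => C a ‖y‖) hx),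
      D_B_eq_neg_shellWeight_div hx hy hxy, hDC x hx y hy, mulHaar_real_E, mul_inv]
    ring
  refine ⟨C, fun x _ y _ => by rw [B_comm, hC],
    continuousOn_of_norm_congr (G := fun x y => B p m x y + C ‖x‖ ‖y‖)
      fun x y x' y' hx hy h => by rw [B_congr hx hy h, hx, hy],
    fun y hy => integrableOn_mulHaar_iff.2 (hint y hy), fun y hy φ hφ => ?_⟩
  have hconst : ∀ x ∈ E p m, ∀ z, ‖z - x‖ < ‖x - y‖ → ‖z - x‖ < ‖x‖ →
      B p m z y + C ‖z‖ ‖y‖ = B p m x y + C ‖x‖ ‖y‖ := fun x _ z hzy hzx => by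
    have hz := norm_eq_of_norm_sub_lt hzx
    rw [B_congr hz rfl (norm_sub_eq_of_norm_sub_lt hzy), hz]
  rw [setIntegral_mul_D_of_D_eq_const hy (hint y hy) hconst (hD y hy) hφ]
  field_simp
  ring

end Existence

end TateCurve

theorem mainTheorem2 (p : ℕ) [Fact p.Prime] (m : ℕ) (hm : 1 ≤ m) :
    -- there is a Green's function of the form `B + C`, with `C` depending only on `|x|` and `|y|`,
    (∃ C : ℝ → ℝ → ℝ, TateCurve.IsGreen p m fun x y => TateCurve.B p m x y + C ‖x‖ ‖y‖) ∧
    -- and every symmetric Green's function is of this form;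
    (∀ G : ℚ_[p] → ℚ_[p] → ℝ, TateCurve.IsGreen p m G →
      ∃ C : ℝ → ℝ → ℝ, ∀ x ∈ TateCurve.E p m, ∀ y ∈ TateCurve.E p m, x ≠ y →
        G x y = TateCurve.B p m x y + C ‖x‖ ‖y‖) ∧
    -- the series in `A` and `B` converge absolutely;
    (∀ y ∈ TateCurve.E p m, Summable fun n : ℕ => |TateCurve.lambda p m (n + 1) y|) ∧
    (∀ x ∈ TateCurve.E p m, ∀ y ∈ TateCurve.E p m,
      Summable fun n : ℕ => |TateCurve.lambda p m (n + 1) y * TateCurve.d p x y ^ (n + 1)|) ∧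
    -- off the diagonal, `D` of `B` and of each of its terms is an absolutely convergent integral,
    -- `DB` is the sum of the absolutely convergent series of the terms, and has a closed form;
    (∀ x ∈ TateCurve.E p m, ∀ y ∈ TateCurve.E p m, x ≠ y →
      TateCurve.DConverges p m (fun z => TateCurve.B p m z y) x ∧
      TateCurve.DConverges p m (fun z => Real.logb p (TateCurve.d p z y)) x ∧
      (∀ n : ℕ, TateCurve.DConverges p m (fun z => TateCurve.d p z y ^ (n + 1)) x) ∧
      (Summable fun n : ℕ => |TateCurve.lambda p m (n + 1) y *
        TateCurve.D p m (fun z => TateCurve.d p z y ^ (n + 1)) x|) ∧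
      TateCurve.D p m (fun z => TateCurve.B p m z y) x =
        TateCurve.lambda0 p * TateCurve.D p m (fun z => Real.logb p (TateCurve.d p z y)) x +
          ∑' n : ℕ, TateCurve.lambda p m (n + 1) y *
            TateCurve.D p m (fun z => TateCurve.d p z y ^ (n + 1)) x ∧
      TateCurve.D p m (fun z => TateCurve.B p m z y) x =
        -TateCurve.lambda0 p * (p : ℝ) ^ (-|x.valuation - y.valuation|) *
          (((p : ℝ) + 1) / (((p : ℝ) - 1) * ((p : ℝ) + 1 - TateCurve.U p m y)))) ∧
    -- in particular `DB(x, y)` depends only on `|x|` and `|y|` off the diagonal.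
    (∀ x ∈ TateCurve.E p m, ∀ y ∈ TateCurve.E p m, ∀ x' ∈ TateCurve.E p m,
      ∀ y' ∈ TateCurve.E p m, x ≠ y → x' ≠ y' → ‖x‖ = ‖x'‖ → ‖y‖ = ‖y'‖ →
      TateCurve.D p m (fun z => TateCurve.B p m z y) x =
        TateCurve.D p m (fun z => TateCurve.B p m z y') x') := by
  obtain ⟨C, hC⟩ := TateCurve.exists_isGreen p hm
  refine ⟨⟨C, hC⟩, fun G hG => ?_, fun y hy => (TateCurve.summable_lambda hy).abs,
    fun x _ y hy => (TateCurve.summable_lambda_mul_pow hy (TateCurve.d_nonneg x y)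
      (TateCurve.d_le_one x y)).abs, fun x hx y hy hxy => ?_,
    fun x hx y hy x' hx' y' hy' hxy hxy' hxx' hyy' => ?_⟩
  · obtain ⟨k, hk⟩ := hG.exists_eq_add_const hm hC
    exact ⟨fun a b => C a b + k, fun x hx y hy hxy => by rw [hk x hx y hy hxy, add_assoc]⟩
  · have hsum := TateCurve.hasSum_lambda_mul_D_d_pow hx hy hxy
    exact ⟨(TateCurve.dConverges_B_and_D_B_eq hx hy hxy).1, TateCurve.dConverges_logb_d hx hy hxy,
      fun n => TateCurve.dConverges_d_pow hx hy hxy (n + 1), hsum.summable.abs,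
      by rw [hsum.tsum_eq, add_sub_cancel], TateCurve.D_B_eq hx hy hxy⟩
  · rw [(TateCurve.dConverges_B_and_D_B_eq hx hy hxy).2,
      (TateCurve.dConverges_B_and_D_B_eq hx' hy' hxy').2, TateCurve.ratio, TateCurve.ratio,
      TateCurve.U, TateCurve.U, hxx', hyy']
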